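/- Let $\beta$ be a Pisot number, that is, a real algebraic integer $\beta>1$ all of whose Galois conjugates other than $\beta$ itself have modulus less than $1$, and assume that $\beta$ has no other positive real conjugate. Let $T:[0,1]\to[0,1]$, $T(x)=\{\beta x\}$, and let $\lambda$ be Lebesgue measure on $[0,1]$. For a map $S:[0,1]\to[0,1]$ and a probability measure $\nu$, a point $x$ is $(S,\nu)$-generic if $\frac1N\sum_{n=0}^{N-1}f(S^nx)\to\int f\,d\nu$ for every continuous $f:[0,1]\to\mathbb R$. Two systems $(S,\nu)$ and $(S',\nu')$ are generic point equivalent if both are ergodic probability measure preserving systems and have the same generic points. An expression of $1$ is a finitely supported sequence $(a_i)_{i\ge1}$ of nonnegative integers with $1=\sum_{i\ge1}a_i\beta^{-i}$. A map $S:[0,1]\to[0,1]$ is called built from $(a_i)$ if there are points $0=t_0<t_1<\dots<t_N=1$ such that, for each $i\geq 1$, exactly $a_i$ of the $N=\sum_i a_i$ intervals $(t_{k-1},t_k)$ have length $\beta^{-i}$ (the intervals may come in any order), $S$ is affine with slope $\beta^i$ or $-\beta^i$ on each interval $(t_{k-1},t_k)$ of length $\beta^{-i}$, and $S(x)\in\{0,1\}$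 at every discontinuity $x$ of $S$. A point $x$ is $S$-normal if every finite word $w=(w_0,\dots,w_{L-1})$ in $\{1,\dots,N\}$ occurs in the digit sequence of $x$ with the right frequency: with $C_w=\{y: S^k y\in(t_{w_k-1},t_{w_k})\text{ for }0\le k<L\}$, one has $\frac1n\#\{0\le j<n: S^jx\in C_w\}\to\lambda(C_w)$. Then: 1. $T$ has exactly one absolutely continuous invariant probability measure, $\mu_\beta$. 2. If there is an expression of $1$, then there are infinitely many. 3. For every expression $(a_i)$ of $1$ and every map $S$ built from it, $\lambda$ is invariant under $S$, and it is the only absolutely continuous $S$-invariant probability measure. Moreover $(S,\lambda)$ and $(T,\mu_\beta)$ are generic point equivalent; in particular both systems are ergodic. 4. Any two maps $S,S'$ built from expressions of $1$ in powers of $\beta^{-1}$ (possibly two different expressions, with the same $\beta$) are normality equivalent: $(S,\lambda)$ and $(S',\lambda)$ are generic point equivalent, and a point is $S$-normal if and only if it is $S'$-normal. -/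

import Mathlib

open MeasureTheory Filter Topology unitInterval

/-- A Pisot number: a real algebraic integer greater than one, all of whose Galois conjugates
other than itself have modulus less than one. -/
def IsPisot (β : ℝ) : Prop :=
  IsIntegral ℤ β ∧ 1 < β ∧
    ∀ z : ℂ, Polynomial.aeval z (minpoly ℚ β) = 0 → z ≠ (β : ℂ) → ‖z‖ < 1

/-- `β` has no Galois conjugate that is a positive real number, except itself. -/
def NoOtherPositiveConjugate (β : ℝ) : Prop :=
  ∀ y : ℝ, Polynomial.aeval y (minpoly ℚ β) = 0 → 0 < y → y = β

/-- The beta transformation `x ↦ {β x}` on the unit interval. -/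
noncomputable def betaMap (β : ℝ) (x : I) : I :=
  ⟨Int.fract (β * x), Int.fract_nonneg _, (Int.fract_lt_one _).le⟩

/-- `μ` is a probability measure, absolutely continuous with respect to Lebesgue measure on
`[0,1]`, and invariant under `T`. -/
structure IsACIP (T : I → I) (μ : Measure I) : Prop where
  prob : IsProbabilityMeasure μ
  ac : μ ≪ volume
  invariant : MeasurePreserving T μ μ

/-- `x` is a generic point of the system `(T, μ)`: for every continuous `f`, the averages
`(1/N) ∑_{n < N} f (T^n x)` converge to the integral of `f`. -/
def IsGenericForMeasure {X : Type*} [TopologicalSpace X] [MeasurableSpace X]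
    (T : X → X) (μ : Measure X) (x : X) : Prop :=
  ∀ f : C(X, ℝ), Tendsto (fun N : ℕ => birkhoffAverage ℝ T f N x) atTop (𝓝 (∫ y, f y ∂μ))

/-- Generic point equivalence of two ergodic probability preserving systems on the same space:
their sets of generic points coincide. -/
structure GenericPointEquivalent {X : Type*} [TopologicalSpace X] [MeasurableSpace X]
    (S : X → X) (ν : Measure X) (T : X → X) (μ : Measure X) : Prop where
  prob_left : IsProbabilityMeasure ν
  prob_right : IsProbabilityMeasure μ
  ergodic_left : Ergodic S ν
  ergodic_right : Ergodic T μ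
  generic_iff : {x | IsGenericForMeasure S ν x} = {x | IsGenericForMeasure T μ x}

/-- The expressions `1 = ∑_{i ≥ 1} a i / β ^ i` with finitely many nonzero coefficients, all of
them nonnegative integers. -/
def unitExpressions (β : ℝ) : Set (ℕ →₀ ℕ) :=
  {a | a 0 = 0 ∧ (1 : ℝ) = a.sum fun i n => (n : ℝ) / β ^ i}

/-- A piecewise linear map of `[0,1]` built from `β` and `a`: the points
`0 = t 0 < t 1 < ⋯ < t N = 1` cut `[0,1]` into `N` intervals, of which exactly `a i` have length
`β ^ (-i)`, in any order; inside an interval of length `β ^ (-i)` the map is affine with slope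
`β ^ i` or `-β ^ i`; and the map takes the value `0` or `1` at each of its discontinuities. -/
structure LurothMap (β : ℝ) (a : ℕ →₀ ℕ) where
  N : ℕ
  t : Fin (N + 1) → I
  t_zero : t 0 = 0
  t_last : t (Fin.last N) = 1
  m : Fin N → ℕ
  length_eq : ∀ k : Fin N, (t k.succ : ℝ) - (t k.castSucc : ℝ) = (β ^ m k)⁻¹
  card_eq : ∀ i : ℕ, (Finset.univ.filter fun k : Fin N => m k = i).card = a i
  sign : Fin N → ℤˣ
  intercept : Fin N → ℝ
  toFun : I → I
  affine : ∀ (k : Fin N) (x : I), x ∈ Set.Ioo (t k.castSucc) (t k.succ) →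
    (toFun x : ℝ) = ((sign k : ℤ) : ℝ) * β ^ m k * (x : ℝ) + intercept k
  discontinuity : ∀ x : I, ¬ ContinuousAt toFun x → toFun x = 0 ∨ toFun x = 1

namespace LurothMap

/-- The points `x` whose first digits are `w`: `S^k x` lies inside the interval number `w k`
for each `k < L`. -/
def cylinder {β : ℝ} {a : ℕ →₀ ℕ} (S : LurothMap β a) {L : ℕ} (w : Fin L → Fin S.N) :
    Set I :=
  {x | ∀ k : Fin L, S.toFun^[k] x ∈ Set.Ioo (S.t (w k).castSucc) (S.t (w k).succ)}

open Classical in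
/-- `x` is normal with respect to `S`: each finite pattern `w` of digits occurs in the digit
sequence of `x` with asymptotic relative frequency equal to the Lebesgue measure of the
cylinder of `w`. -/
def IsNormal {β : ℝ} {a : ℕ →₀ ℕ} (S : LurothMap β a) (x : I) : Prop :=
  ∀ (L : ℕ) (w : Fin L → Fin S.N),
    Tendsto
      (fun n : ℕ =>
        (((Finset.range n).filter fun j => S.toFun^[j] x ∈ S.cylinder w).card : ℝ) / (n : ℝ))
      atTop (𝓝 (volume.real (S.cylinder w)))

end LurothMap

/-- Normality equivalence: the same points are normal with respect to `S` and to `S'`. -/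
def NormalityEquivalent {β : ℝ} {a a' : ℕ →₀ ℕ}
    (S : LurothMap β a) (S' : LurothMap β a') : Prop :=
  {x | S.IsNormal x} = {x | S'.IsNormal x}

/-! The link between the systems is a density bound on orbits: `HasDensityBound` says that the upper
frequency of visits to any closed set is at most a constant times its Lebesgue measure. If Lebesgue
measure is nonsingular enough for `U` (`TameMap`) and `U` has a unique absolutely continuous
invariant probability `μ`, then any orbit with such a bound is generic for `μ`: every limit of its
empirical measures is absolutely continuous and invariant, hence equal to `μ`
(`generic_of_hasDensityBound`). Conversely, a generic point of a measure with bounded density has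
the bound. Genericity thus becomes a property insensitive to constants, which can be carried from
one map to another.

Uniqueness and ergodicity come from `ZeroOneLaw`. Short affine branches onto `(0, 1)` reproduce the
global proportion of an invariant set at small scales, so the Lebesgue density theorem forces that
proportion to be 0 or 1. Existence for `T` is Parry's explicit density; the maps `S` preserve
Lebesgue measure because their branches are full.

The arithmetic enters in `exists_coupling`. Follow the orbits of `x` under `S` and `T`, matching
times so that the same power of `β` has been applied. Up to sign, the points differ by a number `w`
obtained by iterating `w ↦ ±β^m w + e` with `e` in a finite subset of `ℤ[β, β⁻¹]`. At the conjugates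
of modulus less than 1 this iteration contracts, and the real value is bounded because both points
lie in `[0, 1]`; denominators do not grow. Hence only finitely many `w` occur
(`IsPisot.finite_affineReach`). The orbits are then related by finitely many affine maps with
bounded time gaps, and density bounds pass both ways (`HasDensityBound.of_affine`).

Normality of `x` for `S` is also equivalent to genericity: cylinders are intervals with null
boundary, and conversely fine cylinders approximate closed sets from outside, giving a density
bound. -/

/-! ### Full affine branches -/

/-- On the interval `(a, b)` the map `U` is affine with slope `r`, and the length of `(a, b)` is
`1 / |r|`, so that `U` maps `(a, b)` onto `(0, 1)`. -/
structure FullBranch (U : I → I) (a b r c : ℝ) : Prop where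
  nonneg : 0 ≤ a
  le_one : b ≤ 1
  slope : |r| * (b - a) = 1
  affine : ∀ x : I, a < (x : ℝ) → (x : ℝ) < b → (U x : ℝ) = r * x + c

namespace FullBranch

variable {U V : I → I} {a b r c a' b' r' c' : ℝ}

lemma lt (h : FullBranch U a b r c) : a < b := by
  by_contra! hba
  nlinarith [h.slope, abs_nonneg r]

lemma slope_ne_zero (h : FullBranch U a b r c) : r ≠ 0 := by
  rintro rfl
  simpa using h.slope

lemma mem_Icc_of_mem_Icc (h : FullBranch U a b r c) {x : ℝ} (hx : x ∈ Set.Icc a b) :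
    r * x + c ∈ Set.Icc (0 : ℝ) 1 := by
  have hcl : IsClosed {x : ℝ | r * x + c ∈ Set.Icc (0 : ℝ) 1} :=
    isClosed_Icc.preimage (by fun_prop)
  have hsub : Set.Ioo a b ⊆ {x : ℝ | r * x + c ∈ Set.Icc (0 : ℝ) 1} := by
    intro y hy
    have := h.affine ⟨y, by linarith [hy.1, h.nonneg], by linarith [hy.2, h.le_one]⟩ hy.1 hy.2
    simp only [Set.mem_ofPred_eq] at this ⊢
    rw [← this]
    exact (U _).2
  have := closure_minimal hsub hcl
  rw [closure_Ioo h.lt.ne] at this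
  exact this hx

/-- The affine image of `[a, b]` lies in `[0, 1]` and has length 1, so the endpoints must map
exactly to 0 and 1. -/
lemma endpoints (h : FullBranch U a b r c) :
    (0 < r ∧ r * a + c = 0 ∧ r * b + c = 1) ∨ (r < 0 ∧ r * a + c = 1 ∧ r * b + c = 0) := by
  have ha := h.mem_Icc_of_mem_Icc (Set.left_mem_Icc.2 h.lt.le)
  have hb := h.mem_Icc_of_mem_Icc (Set.right_mem_Icc.2 h.lt.le)
  have hs := h.slope
  rcases lt_or_gt_of_ne h.slope_ne_zero with h0 | h0
  · rw [abs_of_neg h0] at hs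
    exact Or.inr ⟨h0, by linarith [ha.2, hb.1], by linarith [ha.2, hb.1]⟩
  · rw [abs_of_pos h0] at hs
    exact Or.inl ⟨h0, by linarith [ha.1, hb.2], by linarith [ha.1, hb.2]⟩

lemma affine_mem_Ioo_iff (h : FullBranch U a b r c) (x : ℝ) :
    r * x + c ∈ Set.Ioo (0 : ℝ) 1 ↔ x ∈ Set.Ioo a b := by
  rcases h.endpoints with ⟨h0, h1, h2⟩ | ⟨h0, h1, h2⟩
  · constructor
    · rintro ⟨h3, h4⟩
      exact ⟨by nlinarith, by nlinarith⟩
    · rintro ⟨h3, h4⟩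
      exact ⟨by nlinarith, by nlinarith⟩
  · constructor
    · rintro ⟨h3, h4⟩
      exact ⟨by nlinarith, by nlinarith⟩
    · rintro ⟨h3, h4⟩
      exact ⟨by nlinarith, by nlinarith⟩

lemma length_eq (h : FullBranch U a b r c) : b - a = |r|⁻¹ :=
  eq_inv_of_mul_eq_one_right h.slope

lemma comp (hV : FullBranch V a' b' r' c') (hU : FullBranch U a b r c) :
    ∃ a₁ b₁ c₁, FullBranch (V ∘ U) a₁ b₁ (r' * r) c₁ ∧
      ∀ x : I, (a₁ < (x : ℝ) ∧ (x : ℝ) < b₁) ↔ ((a < (x : ℝ) ∧ (x : ℝ) < b) ∧ a' < (U x : ℝ) ∧ (U x : ℝ) < b') := by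
  have hs := hU.slope
  have hs' := hV.slope
  have hr := hU.slope_ne_zero
  -- The new branch is the preimage of `(a', b')` under the affine formula; a negative slope
  -- exchanges the endpoints.
  have key : ∀ a₁ b₁ : ℝ, a₁ = (if 0 < r then (a' - c) / r else (b' - c) / r) →
      b₁ = (if 0 < r then (b' - c) / r else (a' - c) / r) →
      b₁ - a₁ = (b' - a') / |r| ∧
      (∀ y : ℝ, (a₁ < y ∧ y < b₁) ↔ (a' < r * y + c ∧ r * y + c < b')) ∧ a ≤ a₁ ∧ b₁ ≤ b := by
    intro a₁ b₁ h1 h2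
    have hn := hV.nonneg
    have hl := hV.le_one
    rcases hU.endpoints with ⟨h0, e1, e2⟩ | ⟨h0, e1, e2⟩
    · rw [if_pos h0] at h1 h2
      rw [abs_of_pos h0]
      subst h1 h2
      refine ⟨by ring, fun y => ?_, ?_, ?_⟩
      · rw [div_lt_iff₀ h0, lt_div_iff₀ h0]
        constructor <;> rintro ⟨_, _⟩ <;> constructor <;> linarith
      · rw [le_div_iff₀ h0]; linarith
      · rw [div_le_iff₀ h0]; linarith
    · rw [if_neg h0.not_gt] at h1 h2
      rw [abs_of_neg h0]
      subst h1 h2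
      refine ⟨by field_simp; ring, fun y => ?_, ?_, ?_⟩
      · rw [div_lt_iff_of_neg h0, lt_div_iff_of_neg h0]
        constructor <;> rintro ⟨_, _⟩ <;> constructor <;> linarith
      · rw [le_div_iff_of_neg h0]; linarith
      · rw [div_le_iff_of_neg h0]; linarith
  obtain ⟨k1, k2, k3, k4⟩ := key _ _ rfl rfl
  generalize (if 0 < r then (a' - c) / r else (b' - c) / r) = a₁ at *
  generalize (if 0 < r then (b' - c) / r else (a' - c) / r) = b₁ at *
  refine ⟨a₁, b₁, r' * c + c', ⟨hU.nonneg.trans k3, k4.trans hU.le_one, ?_, ?_⟩, ?_⟩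
  · rw [k1, abs_mul]
    have : |r| ≠ 0 := abs_ne_zero.2 hr
    field_simp
    linarith
  · intro x hx1 hx2
    have hUx := hU.affine x (by linarith) (by linarith)
    have := (k2 x).1 ⟨hx1, hx2⟩
    rw [Function.comp_apply, hV.affine (U x) (by rw [hUx]; exact this.1)
      (by rw [hUx]; exact this.2), hUx]
    ring
  · intro x
    constructor
    · rintro ⟨hx1, hx2⟩
      have hx : a < (x : ℝ) ∧ (x : ℝ) < b := ⟨by linarith, by linarith⟩
      rw [hU.affine x hx.1 hx.2]
      exact ⟨hx, (k2 x).1 ⟨hx1, hx2⟩⟩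
    · rintro ⟨hx, h2⟩
      rw [hU.affine x hx.1 hx.2] at h2
      exact (k2 x).2 h2

end FullBranch

lemma unitInterval.measure_inter_Ioo (A : Set I) :
    volume (A ∩ {x : I | 0 < (x : ℝ) ∧ (x : ℝ) < 1}) = volume A := by
  refine le_antisymm (measure_mono Set.inter_subset_left) ?_
  have hsub : A ⊆ (A ∩ {x : I | 0 < (x : ℝ) ∧ (x : ℝ) < 1}) ∪ ({0, 1} : Set I) := by
    intro x hx
    by_cases h0 : x = 0
    · right; simp [h0]
    by_cases h1 : x = 1
    · right; simp [h1]
    left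
    exact ⟨hx, lt_of_le_of_ne x.2.1 fun h => h0 (Subtype.ext h.symm),
      lt_of_le_of_ne x.2.2 fun h => h1 (Subtype.ext h)⟩
  refine (measure_mono hsub).trans ((measure_union_le _ _).trans ?_)
  have : volume ({0, 1} : Set I) = 0 := (Set.toFinite _).measure_zero _
  rw [this, add_zero]

lemma volume_preimage_affine {r : ℝ} (hr : r ≠ 0) (c : ℝ) (A : Set ℝ) :
    volume ((fun x : ℝ => r * x + c) ⁻¹' A) = ENNReal.ofReal |r|⁻¹ * volume A := by
  have : (fun x : ℝ => r * x + c) ⁻¹' A = (fun x => r * x) ⁻¹' ((fun x => x + c) ⁻¹' A) := rfl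
  rw [this, Real.volume_preimage_mul_left hr, measure_preimage_add_right, abs_inv]

/-- Inside a full branch, the proportion of points landing in `A` is the measure of `A`. Both the
density argument and the invariance of Lebesgue measure rest on this. -/
lemma FullBranch.volume_inter_preimage {U : I → I} {a b r c : ℝ} (h : FullBranch U a b r c)
    (A : Set I) :
    volume ({x : I | a < (x : ℝ) ∧ (x : ℝ) < b} ∩ U ⁻¹' A) = ENNReal.ofReal (b - a) * volume A := by
  rw [← unitInterval.measure_inter_Ioo A, volume_apply, volume_apply, h.length_eq,
    ← volume_preimage_affine h.slope_ne_zero c]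
  congr 1
  ext x
  constructor
  · rintro ⟨y, ⟨⟨h1, h2⟩, h3⟩, rfl⟩
    have h4 := h.affine y h1 h2
    refine ⟨U y, ⟨h3, ?_⟩, h4⟩
    rw [Set.mem_ofPred_eq, h4]
    exact (h.affine_mem_Ioo_iff y).2 ⟨h1, h2⟩
  · rintro ⟨y, ⟨h1, h2⟩, h3⟩
    simp only at h3
    have hx : x ∈ Set.Ioo a b := (h.affine_mem_Ioo_iff x).1 (by rw [← h3]; exact h2)
    refine ⟨⟨x, by linarith [hx.1, h.nonneg], by linarith [hx.2, h.le_one]⟩, ⟨hx, ?_⟩, rfl⟩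
    have : U ⟨x, by linarith [hx.1, h.nonneg], by linarith [hx.2, h.le_one]⟩ = y :=
      Subtype.ext ((h.affine _ hx.1 hx.2).trans h3.symm)
    rwa [Set.mem_preimage, this]

/-! ### Zero-one law by Lebesgue density -/

/-- Every invariant set of positive measure has full measure, if almost every point has arbitrarily
short full branches of iterates at a distance comparable to their length. -/
theorem measure_compl_eq_zero_of_fullBranch {U : I → I} (K : ℝ)
    (h : ∀ᵐ x : I, ∀ ε > 0, ∃ (n : ℕ) (a b r c : ℝ), FullBranch (U^[n]) a b r c ∧ b - a < ε ∧
      |(x : ℝ) - (a + b) / 2| ≤ K * ((b - a) / 2))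
    {A : Set I} (hA : MeasurableSet A) (hinv : U ⁻¹' A = A) (hpos : volume A ≠ 0) :
    volume Aᶜ = 0 := by
  have hiter : ∀ n : ℕ, (U^[n]) ⁻¹' A = A := fun n => by
    rw [Set.preimage_iterate_eq]; exact Function.iterate_fixed hinv n
  set S : Set ℝ := Subtype.val '' A with hS
  have hSm : MeasurableSet S := measurableEmbedding_coe.measurableSet_image' hA
  -- This density theorem allows balls that do not contain `x`, as long as `x` lies within `K` radii
  -- of the centre.
  have hdens := IsUnifLocDoublingMeasure.ae_tendsto_measure_inter_div (volume : Measure ℝ) S K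
  rw [ae_restrict_iff' hSm] at hdens
  obtain ⟨x, hxA, hx, hd⟩ : ∃ x : I, x ∈ A ∧ (∀ ε > 0, ∃ (n : ℕ) (a b r c : ℝ),
      FullBranch (U^[n]) a b r c ∧ b - a < ε ∧ |(x : ℝ) - (a + b) / 2| ≤ K * ((b - a) / 2)) ∧
      (∀ {ι : Type} {l : Filter ι} (w : ι → ℝ) (δ : ι → ℝ) (_ : Tendsto δ l (𝓝[>] 0))
      (_ : ∀ᶠ j in l, (x : ℝ) ∈ Metric.closedBall (w j) (K * δ j)),
      Tendsto (fun j => volume (S ∩ Metric.closedBall (w j) (δ j)) /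
        volume (Metric.closedBall (w j) (δ j))) l (𝓝 1)) := by
    by_contra! hcon
    apply hpos
    have hnull := ae_iff.1 h
    rw [volume_apply] at hnull ⊢
    rw [ae_iff] at hdens
    refine measure_mono_null ?_ (measure_union_null hnull hdens)
    rintro _ ⟨y, hy, rfl⟩
    by_cases hy2 : (∀ ε > 0, ∃ (n : ℕ) (a b r c : ℝ),
      FullBranch (U^[n]) a b r c ∧ b - a < ε ∧ |(y : ℝ) - (a + b) / 2| ≤ K * ((b - a) / 2))
    · right
      intro hd
      obtain ⟨ι, l, w, δ, h1, h2, h3⟩ := hcon y hy hy2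
      exact h3 (hd ⟨y, hy, rfl⟩ w δ h1 h2)
    · left
      exact ⟨y, hy2, rfl⟩
  have hch := fun j : ℕ => hx (1 / ((j : ℝ) + 1)) (by positivity)
  choose n a b r c hfb hlen hmem using hch
  have hball : ∀ j, Metric.closedBall ((a j + b j) / 2) ((b j - a j) / 2) = Set.Icc (a j) (b j) := by
    intro j
    rw [Real.closedBall_eq_Icc]
    congr 1 <;> ring
  have hlim := hd (l := atTop) (fun j => (a j + b j) / 2) (fun j => (b j - a j) / 2) (by
    rw [tendsto_nhdsWithin_iff]
    constructor
    · refine squeeze_zero (fun j => ?_) (fun j => ?_) tendsto_one_div_add_atTop_nhds_zero_nat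
      · linarith [(hfb j).lt]
      · linarith [hlen j, (hfb j).lt]
    · exact Eventually.of_forall fun j => half_pos (sub_pos.2 (hfb j).lt))
    (Eventually.of_forall fun j => by rw [Metric.mem_closedBall, Real.dist_eq]; exact hmem j)
  -- By invariance of `A` under the iterate, its relative measure in every branch interval is its
  -- global measure; the density limit 1 then gives full measure.
  have hconst : ∀ j, volume (S ∩ Metric.closedBall ((a j + b j) / 2) ((b j - a j) / 2)) /
        volume (Metric.closedBall ((a j + b j) / 2) ((b j - a j) / 2)) = volume A := by
    intro j
    rw [hball, Real.volume_Icc]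
    have h1 := (hfb j).volume_inter_preimage A
    rw [hiter, volume_apply] at h1
    have h2 : volume (S ∩ Set.Icc (a j) (b j)) = ENNReal.ofReal (b j - a j) * volume A := by
      rw [← h1]
      have : (Subtype.val '' ({x : I | a j < (x : ℝ) ∧ (x : ℝ) < b j} ∩ A)) = S ∩ Set.Ioo (a j) (b j) := by
        rw [Set.inter_comm, hS]
        exact Set.image_inter_preimage Subtype.val A (Set.Ioo (a j) (b j))
      rw [this]
      exact measure_congr ((ae_eq_refl S).inter Ioo_ae_eq_Icc.symm)
    rw [h2, mul_comm, ENNReal.mul_div_cancel_right]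
    · simpa using (hfb j).lt
    · exact ENNReal.ofReal_ne_top
  simp only [hconst] at hlim
  have := tendsto_nhds_unique hlim tendsto_const_nhds
  exact (prob_compl_eq_zero_iff hA).2 this.symm

/-- The conclusion of the zero-one law for invariant sets of a map of the unit interval. -/
def ZeroOneLaw (U : I → I) : Prop :=
  ∀ A : Set I, MeasurableSet A → U ⁻¹' A = A → volume A ≠ 0 → volume Aᶜ = 0

lemma ZeroOneLaw.ergodic {U : I → I} (h : ZeroOneLaw U) {μ : Measure I} (hμ : IsACIP U μ) :
    Ergodic U μ := by
  refine ⟨hμ.invariant, ⟨fun A hA hinv => ?_⟩⟩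
  rw [eventuallyConst_set']
  by_cases h0 : volume A = 0
  · left
    exact ae_eq_empty.2 (hμ.ac h0)
  · right
    exact ae_eq_univ.2 (hμ.ac (h A hA hinv h0))

/-- The average of two such measures is again one, hence ergodic. Each of the two is invariant and
absolutely continuous with respect to it, so equals it. -/
lemma ZeroOneLaw.unique {U : I → I} (h : ZeroOneLaw U) {μ ν : Measure I} (hμ : IsACIP U μ)
    (hν : IsACIP U ν) : μ = ν := by
  have := hμ.prob
  have := hν.prob
  set ρ : Measure I := (2⁻¹ : ENNReal) • (μ + ν) with hρ
  have hacip : IsACIP U ρ := by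
    refine ⟨⟨?_⟩, ?_, ?_⟩
    · simp only [hρ, Measure.smul_apply, Measure.add_apply, measure_univ, smul_eq_mul]
      rw [one_add_one_eq_two, ENNReal.inv_mul_cancel] <;> simp
    · exact (Measure.AbsolutelyContinuous.add_left hμ.ac hν.ac).smul_left _
    · refine MeasurePreserving.smul_measure ⟨hμ.invariant.measurable, ?_⟩ _
      rw [Measure.map_add _ _ hμ.invariant.measurable, hμ.invariant.map_eq, hν.invariant.map_eq]
  have := hacip.prob
  have hsm : μ + ν ≪ ρ := Measure.absolutelyContinuous_smul (by simp)
  rw [(h.ergodic hacip).eq_of_absolutelyContinuous hμ.invariant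
    ((Measure.AbsolutelyContinuous.rfl.add_right ν).trans hsm),
    (h.ergodic hacip).eq_of_absolutelyContinuous hν.invariant
    ((add_comm ν μ ▸ Measure.AbsolutelyContinuous.rfl.add_right μ : ν ≪ μ + ν).trans hsm)]

/-! ### Genericity and density bounds -/

/-- A measurable map of the unit interval that is continuous almost everywhere and has null
fibers. -/
structure TameMap (U : I → I) : Prop where
  measurable : Measurable U
  discontinuity_null : volume {x | ¬ ContinuousAt U x} = 0
  fiber_null : ∀ a, volume (U ⁻¹' {a}) = 0

open Classical in
/-- The number of visits of the sequence `y` to the set `A` before time `n`. -/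
noncomputable def visits (y : ℕ → I) (A : Set I) (n : ℕ) : ℕ :=
  ((Finset.range n).filter fun j => y j ∈ A).card

/-- The upper visit frequency of `y` to any closed set is at most `C` times its length. -/
def HasDensityBound (y : ℕ → I) (C : ℝ) : Prop :=
  ∀ K : Set I, IsClosed K → ∀ δ > 0, ∀ᶠ n in atTop,
    (visits y K n : ℝ) ≤ (C * volume.real K + δ) * n

lemma Filter.eventually_atTop_succ_iff {p : ℕ → Prop} :
    (∀ᶠ n in atTop, p (n + 1)) ↔ ∀ᶠ n in atTop, p n := by
  conv_rhs => rw [← map_add_atTop_eq_nat 1, eventually_map]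

/-- The empirical measure of the first `N + 1` terms of a sequence. -/
noncomputable def empirical (y : ℕ → I) (N : ℕ) : ProbabilityMeasure I :=
  ⟨((N + 1 : ℕ) : ENNReal)⁻¹ • ∑ n ∈ Finset.range (N + 1), Measure.dirac (y n), ⟨by
    simp only [Measure.smul_apply, Measure.finsetSum_apply, measure_univ, smul_eq_mul,
      Finset.sum_const, Finset.card_range, nsmul_eq_mul, mul_one]
    exact ENNReal.inv_mul_cancel (by simp) (ENNReal.natCast_ne_top _)⟩⟩

lemma visits_mono (y : ℕ → I) {A B : Set I} (h : A ⊆ B) (n : ℕ) : visits y A n ≤ visits y B n := by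
  classical
  unfold visits
  exact Finset.card_le_card fun j hj => by
    simp only [Finset.mem_filter] at hj ⊢
    exact ⟨hj.1, h hj.2⟩

lemma visits_add_compl (y : ℕ → I) (A : Set I) (n : ℕ) : visits y A n + visits y Aᶜ n = n := by
  classical
  unfold visits
  simpa using Finset.card_filter_add_card_filter_not (s := Finset.range n) (fun j => y j ∈ A)

lemma visits_succ (y : ℕ → I) (A : Set I) (n : ℕ) [Decidable (y n ∈ A)] :
    visits y A (n + 1) = visits y A n + if y n ∈ A then 1 else 0 := by
  classical
  unfold visits
  rw [Finset.range_add_one, Finset.filter_insert]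
  split_ifs <;> simp_all

/-- Visits to the preimage are visits to `A` one time unit later, so the two counts differ only in
the first and last terms. -/
lemma visits_iterate_preimage (U : I → I) (x : I) (A : Set I) (n : ℕ) :
    |(visits (fun j => U^[j] x) (U ⁻¹' A) n : ℝ) - visits (fun j => U^[j] x) A n| ≤ 1 := by
  classical
  have key : (visits (fun j => U^[j] x) (U ⁻¹' A) n : ℝ) + (if x ∈ A then 1 else 0)
      = visits (fun j => U^[j] x) A n + if U^[n] x ∈ A then 1 else 0 := by
    induction n with
    | zero =>
      by_cases hx : x ∈ A <;> simp [hx, visits]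
    | succ n ih =>
      have e : U^[n] x ∈ U ⁻¹' A ↔ U^[n + 1] x ∈ A := by
        rw [Function.iterate_succ_apply']; rfl
      rw [visits_succ, visits_succ, if_congr e rfl rfl]
      push_cast
      linarith
  rw [abs_le]
  split_ifs at key <;> constructor <;> linarith

lemma empirical_apply (y : ℕ → I) (N : ℕ) {A : Set I} (hA : MeasurableSet A) :
    (empirical y N : Measure I) A = ENNReal.ofReal (visits y A (N + 1) / (N + 1)) := by
  classical
  have h1 : (empirical y N : Measure I) A
      = ((N + 1 : ℕ) : ENNReal)⁻¹ * ∑ n ∈ Finset.range (N + 1), A.indicator 1 (y n) := by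
    simp only [empirical, ProbabilityMeasure.coe_mk, Measure.smul_apply, Measure.finsetSum_apply,
      smul_eq_mul, Measure.dirac_apply' _ hA]
  rw [h1, ENNReal.ofReal_div_of_pos (by positivity), ENNReal.div_eq_inv_mul]
  congr 1
  · congr 1
    rw [← Nat.cast_succ, ENNReal.ofReal_natCast]
  · rw [ENNReal.ofReal_natCast, visits, Finset.card_filter]
    push_cast
    simp [Set.indicator_apply]

lemma integral_empirical (U : I → I) (x : I) (N : ℕ) (f : I → ℝ) :
    ∫ y, f y ∂(empirical (fun n => U^[n] x) N : Measure I) = birkhoffAverage ℝ U f (N + 1) x := by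
  simp only [empirical, ProbabilityMeasure.coe_mk]
  rw [integral_smul_measure, integral_finsetSum_measure (fun i _ => integrable_dirac (by simp))]
  have : ((N : ENNReal) + 1).toReal = N + 1 := by exact_mod_cast ENNReal.toReal_natCast (N + 1)
  simp [birkhoffAverage, birkhoffSum, this]

lemma isGenericForMeasure_iff_tendsto_empirical (U : I → I) (μ : ProbabilityMeasure I) (x : I) :
    IsGenericForMeasure U (μ : Measure I) x ↔
      Tendsto (empirical fun n => U^[n] x) atTop (𝓝 μ) := by
  rw [ProbabilityMeasure.tendsto_iff_forall_integral_tendsto]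
  simp only [integral_empirical]
  constructor
  · intro h f
    exact (tendsto_add_atTop_iff_nat 1).2 (h f.toContinuousMap)
  · intro h f
    exact (tendsto_add_atTop_iff_nat 1).1 (h (BoundedContinuousFunction.mkOfCompact f))

/-- The portmanteau inequality for closed sets. -/
lemma hasDensityBound_of_generic {U : I → I} {μ : Measure I} [IsProbabilityMeasure μ] {C : ℝ}
    (hC : 0 ≤ C) (hμ : ∀ A, μ A ≤ ENNReal.ofReal C * volume A) {x : I}
    (hx : IsGenericForMeasure U μ x) : HasDensityBound (fun n => U^[n] x) C := by
  intro K hK δ hδ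
  have hlim := (isGenericForMeasure_iff_tendsto_empirical U ⟨μ, inferInstance⟩ x).1 hx
  have hsup := ProbabilityMeasure.limsup_measure_closed_le_of_tendsto hlim hK
  have hlt : atTop.limsup (fun i => (empirical (fun n => U^[n] x) i : Measure I) K)
      < ENNReal.ofReal (C * volume.real K + δ) := by
    refine hsup.trans_lt ((hμ K).trans_lt ?_)
    rw [← ENNReal.ofReal_toReal (measure_ne_top volume K), ← ENNReal.ofReal_mul hC]
    exact (ENNReal.ofReal_lt_ofReal_iff (by positivity)).2 (by simpa [Measure.real] using hδ)
  have hev := eventually_lt_of_limsup_lt hlt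
  rw [← eventually_atTop_succ_iff]
  filter_upwards [hev] with n hn
  rw [empirical_apply _ _ hK.measurableSet] at hn
  have h2 := ((ENNReal.ofReal_lt_ofReal_iff (by positivity)).1 hn).le
  rw [div_le_iff₀ (by positivity)] at h2
  push_cast
  exact h2

/-- A frontier point at which `U` is continuous must satisfy `U x = a`. -/
lemma TameMap.frontier_preimage_null {U : I → I} (hU : TameMap U) (a : I) :
    volume (frontier (U ⁻¹' Set.Iic a)) = 0 := by
  refine measure_mono_null ?_ (measure_union_null hU.discontinuity_null (hU.fiber_null a))
  intro x hx
  by_cases hc : ContinuousAt U x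
  · right
    by_contra hne
    rcases lt_or_gt_of_ne (show U x ≠ a from hne) with h | h
    · have hn : U ⁻¹' Set.Iic a ∈ 𝓝 x := hc.preimage_mem_nhds (Iic_mem_nhds h)
      exact hx.2 (mem_interior_iff_mem_nhds.2 hn)
    · have hn : U ⁻¹' Set.Ioi a ∈ 𝓝 x := hc.preimage_mem_nhds (Ioi_mem_nhds h)
      obtain ⟨y, hy1, hy2⟩ := mem_closure_iff_nhds.1 hx.1 _ hn
      exact not_lt.2 (show U y ≤ a from hy2) (show a < U y from hy1)
  · left
    exact hc

/-- Absolute continuity comes first, from the density bound. It makes the frontiers of the sets `U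
⁻¹' Iic a` null, so weak convergence can be tested on them although `U` is discontinuous; invariance
follows. -/
theorem isACIP_of_ultrafilter_tendsto {U : I → I} (hU : TameMap U) {x : I} {C : ℝ}
    (hb : HasDensityBound (fun n => U^[n] x) C) {g : Ultrafilter ℕ} (hg : (g : Filter ℕ) ≤ atTop)
    {ν : ProbabilityMeasure I} (hν : Tendsto (empirical fun n => U^[n] x) g (𝓝 ν)) :
    IsACIP U (ν : Measure I) := by
  have hclosed : ∀ K : Set I, IsClosed K → volume K = 0 → (ν : Measure I) K = 0 := by
    intro K hK h0
    -- Portmanteau bounds limits from above by open neighbourhoods, while the density bound concerns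
    -- closed sets; hence the open thickening inside the closed one.
    have hle : ∀ δ > 0, ∀ r > 0,
        (ν : Measure I) K ≤ ENNReal.ofReal (C * volume.real (Metric.cthickening r K) + δ) := by
      intro δ hδ r hr
      calc (ν : Measure I) K ≤ (ν : Measure I) (Metric.thickening r K) :=
            measure_mono (Metric.self_subset_thickening hr K)
        _ ≤ (g : Filter ℕ).liminf fun i =>
              (empirical (fun n => U^[n] x) i : Measure I) (Metric.thickening r K) :=
            ProbabilityMeasure.le_liminf_measure_open_of_tendsto hν Metric.isOpen_thickening
        _ ≤ _ := by
            refine liminf_le_of_frequently_le' (Eventually.frequently ?_)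
            have := (eventually_atTop_succ_iff.2
              (hb _ (Metric.isClosed_cthickening (δ := r) (E := K)) δ hδ))
            filter_upwards [hg this] with n hn
            refine (measure_mono (Metric.thickening_subset_cthickening r K)).trans ?_
            rw [empirical_apply _ _ Metric.isClosed_cthickening.measurableSet]
            apply ENNReal.ofReal_le_ofReal
            rw [div_le_iff₀ (by positivity)]
            exact_mod_cast hn
    have hlim : Tendsto (fun r => volume.real (Metric.cthickening r K)) (𝓝[>] 0) (𝓝 0) := by
      have := tendsto_measure_cthickening_of_isClosed (μ := (volume : Measure I)) (s := K)
        ⟨1, one_pos, measure_ne_top _ _⟩ hK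
      rw [h0] at this
      exact ((ENNReal.tendsto_toReal ENNReal.zero_ne_top).comp this).mono_left nhdsWithin_le_nhds
    have hle' : ∀ δ > 0, (ν : Measure I) K ≤ ENNReal.ofReal (C * 0 + δ) := by
      intro δ hδ
      refine ge_of_tendsto (ENNReal.tendsto_ofReal ((hlim.const_mul C).add_const δ)) ?_
      filter_upwards [self_mem_nhdsWithin] with r hr using hle δ hδ r hr
    have hlim0 : Tendsto (fun δ : ℝ => ENNReal.ofReal (C * 0 + δ)) (𝓝[>] 0) (𝓝 0) := by
      have : Tendsto (fun δ : ℝ => ENNReal.ofReal (C * 0 + δ)) (𝓝 0)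
          (𝓝 (ENNReal.ofReal (C * 0 + 0))) :=
        ENNReal.tendsto_ofReal (tendsto_const_nhds.add tendsto_id)
      simp only [mul_zero, add_zero, ENNReal.ofReal_zero] at this ⊢
      exact this.mono_left nhdsWithin_le_nhds
    refine le_antisymm (ge_of_tendsto hlim0 ?_) zero_le
    filter_upwards [self_mem_nhdsWithin] with δ hδ using hle' δ hδ
  have hac : (ν : Measure I) ≪ volume := by
    refine Measure.AbsolutelyContinuous.mk fun A hA h0 => ?_
    rw [hA.measure_eq_iSup_isClosed_of_ne_top (measure_ne_top _ _)]
    simp only [ENNReal.iSup_eq_zero]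
    exact fun K hKA hK => hclosed K hK (measure_mono_null hKA h0)
  refine ⟨inferInstance, hac, hU.measurable, ?_⟩
  have : IsProbabilityMeasure (Measure.map U (ν : Measure I)) :=
    Measure.isProbabilityMeasure_map hU.measurable.aemeasurable
  refine Measure.ext_of_Iic _ _ fun a => ?_
  rw [Measure.map_apply hU.measurable measurableSet_Iic]
  have t1 := ProbabilityMeasure.tendsto_measure_of_null_frontier_of_tendsto' hν
    (hac (hU.frontier_preimage_null a))
  have t2 := ProbabilityMeasure.tendsto_measure_of_null_frontier_of_tendsto' hν
    (E := Set.Iic a) (measure_mono_null (frontier_Iic_subset a) (hac (measure_singleton a)))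
  have r1 := (ENNReal.tendsto_toReal (measure_ne_top _ _)).comp t1
  have r2 := (ENNReal.tendsto_toReal (measure_ne_top _ _)).comp t2
  have hdiff : Tendsto (fun N =>
      ((empirical (fun n => U^[n] x) N : Measure I) (U ⁻¹' Set.Iic a)).toReal
        - ((empirical (fun n => U^[n] x) N : Measure I) (Set.Iic a)).toReal) g (𝓝 0) := by
    refine (squeeze_zero_norm (fun N => ?_) tendsto_one_div_add_atTop_nhds_zero_nat).mono_left hg
    rw [empirical_apply _ _ (hU.measurable measurableSet_Iic), empirical_apply _ _ measurableSet_Iic,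
      ENNReal.toReal_ofReal (by positivity), ENNReal.toReal_ofReal (by positivity), ← sub_div,
      norm_div, Real.norm_eq_abs, Real.norm_of_nonneg (by positivity)]
    gcongr
    exact visits_iterate_preimage U x _ _
  have := tendsto_nhds_unique hdiff (r1.sub r2)
  rw [← ENNReal.toReal_eq_toReal_iff' (measure_ne_top _ _) (measure_ne_top _ _)]
  linarith

/-- An orbit with bounded density is generic for the unique absolutely continuous invariant
probability measure. -/
theorem generic_of_hasDensityBound {U : I → I} (hU : TameMap U) {μ : Measure I}
    [IsProbabilityMeasure μ] (huniq : ∀ ν, IsACIP U ν → ν = μ) {x : I} {C : ℝ}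
    (hb : HasDensityBound (fun n => U^[n] x) C) : IsGenericForMeasure U μ x := by
  refine (isGenericForMeasure_iff_tendsto_empirical U ⟨μ, inferInstance⟩ x).2 ?_
  rw [tendsto_iff_ultrafilter]
  -- By compactness of the space of probability measures, every ultrafilter limit exists, and by
  -- uniqueness it can only be `μ`.
  intro g hg
  obtain ⟨ν, -, hν⟩ := isCompact_univ.ultrafilter_le_nhds
    (g.map (empirical fun n => U^[n] x)) (by simp)
  have hν' : Tendsto (empirical fun n => U^[n] x) g (𝓝 ν) := hν
  have := huniq _ (isACIP_of_ultrafilter_tendsto hU hb hg hν')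
  have h2 : (⟨μ, inferInstance⟩ : ProbabilityMeasure I) = ν := Subtype.ext this.symm
  rw [h2]
  exact hν'

/-- Density bounds pass from `z` to `y` when each `y n` is the image of a term of `z`, of index
at most `D * (n + 1)`, under one of finitely many affine maps, and no term is used more than `D`
times. -/
theorem HasDensityBound.of_affine {y z : ℕ → I} {C : ℝ} (hC : 0 ≤ C) (hz : HasDensityBound z C)
    (Φ : Set (ℝ × ℝ)) (hΦ : Φ.Finite) (D : ℕ) (r : ℕ → ℕ)
    (hr : ∀ n, r n < D * (n + 1)) (hfib : ∀ k N, ((Finset.range N).filter fun n => r n = k).card ≤ D)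
    (hy : ∀ n, ∃ φ ∈ Φ, (z (r n) : ℝ) = φ.1 * y n + φ.2) :
    ∃ C', 0 ≤ C' ∧ HasDensityBound y C' := by
  classical
  have hD : 0 < D := by
    have := hr 0
    by_contra! h
    simp [Nat.le_zero.1 h] at this
  set c : ℝ := ∑ φ ∈ hΦ.toFinset, |φ.1| with hc
  -- One factor `D` pays for repeated indices, the other for the longer time window `D * N`; `c`
  -- sums the expansion factors of the maps applied to `K`.
  refine ⟨D * (D * (c * C)), by positivity, fun K hK δ hδ => ?_⟩
  set img : ℝ × ℝ → Set I := fun φ => {w : I | ∃ v ∈ K, (w : ℝ) = φ.1 * v + φ.2} with himg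
  have himg_closed : ∀ φ, IsClosed (img φ) := by
    intro φ
    have : img φ = (Subtype.val : I → ℝ) ⁻¹' ((fun v : I => φ.1 * (v : ℝ) + φ.2) '' K) := by
      ext w
      simp [himg, eq_comm]
    rw [this]
    exact ((hK.isCompact.image (by fun_prop)).isClosed).preimage continuous_subtype_val
  have himg_vol : ∀ φ, volume.real (img φ) ≤ |φ.1| * volume.real K := by
    intro φ
    rw [measureReal_def, measureReal_def, volume_apply, volume_apply,
      ← ENNReal.toReal_ofReal (abs_nonneg φ.1), ← ENNReal.toReal_mul]
    refine ENNReal.toReal_mono (ENNReal.mul_ne_top ENNReal.ofReal_ne_top ?_) ?_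
    · rw [← volume_apply]; exact measure_ne_top _ _
    by_cases h0 : φ.1 = 0
    · simp only [h0, abs_zero, ENNReal.ofReal_zero, zero_mul, nonpos_iff_eq_zero]
      refine (Set.Finite.subset (Set.finite_singleton φ.2) ?_).measure_zero _
      rintro _ ⟨w, ⟨v, _, hv⟩, rfl⟩
      simpa [h0] using hv
    · have hpre := volume_preimage_affine (inv_ne_zero h0) (-(φ.1⁻¹ * φ.2)) (Subtype.val '' K)
      rw [abs_inv, inv_inv] at hpre
      rw [← hpre]
      refine measure_mono ?_
      rintro _ ⟨w, ⟨v, hv, hw⟩, rfl⟩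
      refine ⟨v, hv, ?_⟩
      rw [hw]
      field_simp
      ring
  have hcount : ∀ N, (visits y K N : ℝ) ≤ ∑ φ ∈ hΦ.toFinset, D * (visits z (img φ) (D * N) : ℝ) := by
    intro N
    have : visits y K N ≤ ∑ φ ∈ hΦ.toFinset, D * visits z (img φ) (D * N) := by
      calc visits y K N
          ≤ (hΦ.toFinset.biUnion fun φ => (Finset.range N).filter fun n => z (r n) ∈ img φ).card := by
            refine Finset.card_le_card fun n hn => ?_
            simp only [Finset.mem_filter, Finset.mem_biUnion, Set.Finite.mem_toFinset] at hn ⊢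
            obtain ⟨φ, hφ, he⟩ := hy n
            exact ⟨φ, hφ, hn.1, y n, hn.2, he⟩
        _ ≤ _ := Finset.card_biUnion_le
        _ ≤ _ := by
            refine Finset.sum_le_sum fun φ _ => ?_
            refine Finset.card_le_mul_card_image_of_maps_to (f := r) ?_ D ?_
            · intro n hn
              simp only [Finset.mem_range, Finset.mem_filter] at hn ⊢
              refine ⟨lt_of_lt_of_le (hr n) (Nat.mul_le_mul_left D hn.1), hn.2⟩
            · intro k _
              refine (Finset.card_le_card ?_).trans (hfib k N)
              intro n hn
              simp only [Finset.mem_filter] at hn ⊢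
              exact ⟨hn.1.1, hn.2⟩
    exact_mod_cast this
  set δ' : ℝ := δ / (D * D * (hΦ.toFinset.card + 1)) with hδ'
  have hD' : (0 : ℝ) < D := by exact_mod_cast hD
  have hδ'pos : 0 < δ' := by positivity
  have hev : ∀ᶠ n in atTop, ∀ φ ∈ hΦ.toFinset,
      (visits z (img φ) n : ℝ) ≤ (C * volume.real (img φ) + δ') * n := by
    rw [Filter.eventually_all_finset]
    exact fun φ _ => hz _ (himg_closed φ) δ' hδ'pos
  have hev2 := (tendsto_id.const_mul_atTop' hD : Tendsto (fun n : ℕ => D * id n) atTop atTop).eventually hev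
  filter_upwards [hev2] with N hN
  calc (visits y K N : ℝ) ≤ ∑ φ ∈ hΦ.toFinset, D * (visits z (img φ) (D * N) : ℝ) := hcount N
    _ ≤ ∑ φ ∈ hΦ.toFinset, D * ((C * (|φ.1| * volume.real K) + δ') * (D * N)) := by
        refine Finset.sum_le_sum fun φ hφ => ?_
        have h1 := hN φ hφ
        simp only [id, Nat.cast_mul] at h1
        have h2 := himg_vol φ
        refine mul_le_mul_of_nonneg_left (h1.trans ?_) hD'.le
        gcongr
    _ = (D * (D * (c * C)) * volume.real K + D * D * hΦ.toFinset.card * δ') * N := by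
        rw [hc, ← Finset.mul_sum, ← Finset.sum_mul, Finset.sum_add_distrib, ← Finset.mul_sum,
          ← Finset.sum_mul, Finset.sum_const, nsmul_eq_mul]
        ring
    _ ≤ _ := by
        gcongr
        rw [hδ', mul_div_assoc', div_le_iff₀ (by positivity)]
        nlinarith [mul_pos (mul_pos hD' hD') hδ]

/-! ### Finiteness from the Pisot property -/

open IntermediateField in
lemma mem_adjoin_and_isIntegral_pow_mul {β : ℝ} (hint : IsIntegral ℤ β) (hβ0 : β ≠ 0) {z : ℝ}
    (hz : z ∈ Algebra.adjoin ℤ ({β, β⁻¹} : Set ℝ)) :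
    z ∈ ℚ⟮β⟯ ∧ ∃ k : ℕ, IsIntegral ℤ (β ^ k * z) := by
  induction hz using Algebra.adjoin_induction with
  | mem x hx =>
    rcases hx with rfl | hx
    · exact ⟨mem_adjoin_simple_self ℚ x, 0, by simpa using hint⟩
    · rw [Set.mem_singleton_iff] at hx
      subst hx
      exact ⟨inv_mem (mem_adjoin_simple_self ℚ β), 1, by
        rw [pow_one, mul_inv_cancel₀ hβ0]; exact isIntegral_one⟩
  | algebraMap r =>
    exact ⟨by simp, 0, by simpa using isIntegral_algebraMap (R := ℤ) (A := ℝ) (x := r)⟩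
  | add x y _ _ hx hy =>
    obtain ⟨hx, k, hk⟩ := hx
    obtain ⟨hy, l, hl⟩ := hy
    refine ⟨add_mem hx hy, k + l, ?_⟩
    have : β ^ (k + l) * (x + y) = β ^ l * (β ^ k * x) + β ^ k * (β ^ l * y) := by ring
    rw [this]
    exact ((hint.pow l).mul hk).add ((hint.pow k).mul hl)
  | mul x y _ _ hx hy =>
    obtain ⟨hx, k, hk⟩ := hx
    obtain ⟨hy, l, hl⟩ := hy
    refine ⟨mul_mem hx hy, k + l, ?_⟩
    have : β ^ (k + l) * (x * y) = (β ^ k * x) * (β ^ l * y) := by ring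
    rw [this]
    exact hk.mul hl

/-- The values reached from the set `E` by maps `z ↦ ± β ^ m * z + e` with `1 ≤ m` and `e ∈ E`. -/
inductive AffineReach (β : ℝ) (E : Set ℝ) : ℝ → Prop
  | base (e : ℝ) (he : e ∈ E) : AffineReach β E e
  | step (z e : ℝ) (u : ℤˣ) (m : ℕ) (hz : AffineReach β E z) (he : e ∈ E) (hm : 1 ≤ m) :
      AffineReach β E (((u : ℤ) : ℝ) * β ^ m * z + e)

-- At an embedding with `‖φ β‖ < 1` each step contracts by at least that factor and adds a bounded
-- term, so a geometric series bounds all reachable values.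
open IntermediateField in
lemma AffineReach.exists_norm_le {β : ℝ} {E : Set ℝ} (hE : E.Finite) (hEK : ∀ e ∈ E, e ∈ ℚ⟮β⟯)
    (φ : ℚ⟮β⟯ →+* ℂ) (hφ : ‖φ (AdjoinSimple.gen ℚ β)‖ < 1) :
    ∃ M : ℝ, ∀ z, AffineReach β E z → ∀ w : ℚ⟮β⟯, (w : ℝ) = z → ‖φ w‖ ≤ M := by
  set γ := AdjoinSimple.gen ℚ β with hγ
  have hfin : {w : ℚ⟮β⟯ | (w : ℝ) ∈ E}.Finite :=
    hE.preimage (Subtype.val_injective.injOn)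
  obtain ⟨M₀, hM₀⟩ := (hfin.image fun w => ‖φ w‖).bddAbove
  set M₁ := max M₀ 0
  have hM₁ : ∀ w : ℚ⟮β⟯, (w : ℝ) ∈ E → ‖φ w‖ ≤ M₁ := fun w hw =>
    (hM₀ ⟨w, hw, rfl⟩).trans (le_max_left _ _)
  have hM₁0 : 0 ≤ M₁ := le_max_right _ _
  have h1 : 0 < 1 - ‖φ γ‖ := by linarith
  refine ⟨M₁ / (1 - ‖φ γ‖), ?_⟩
  have hself : M₁ ≤ M₁ / (1 - ‖φ γ‖) := by
    rw [le_div_iff₀ h1]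
    nlinarith [norm_nonneg (φ γ)]
  intro z hz
  have hK : z ∈ ℚ⟮β⟯ ∧ ∀ w : ℚ⟮β⟯, (w : ℝ) = z → ‖φ w‖ ≤ M₁ / (1 - ‖φ γ‖) := by
    induction hz with
    | base e he => exact ⟨hEK e he, fun w hw => (hM₁ w (hw ▸ he)).trans hself⟩
    | step z e u m hz he hm ih =>
      obtain ⟨hzK, ihb⟩ := ih
      have hβK : β ∈ ℚ⟮β⟯ := mem_adjoin_simple_self ℚ β
      refine ⟨add_mem (mul_mem (mul_mem (intCast_mem _ _) (pow_mem hβK m)) hzK) (hEK e he), ?_⟩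
      intro w hw
      have hw' : w = ((u : ℤ) : ℚ⟮β⟯) * γ ^ m * ⟨z, hzK⟩ + ⟨e, hEK e he⟩ := by
        apply Subtype.ext
        rw [hw]
        simp [hγ]
      have hu : ‖(((u : ℤ) : ℂ))‖ = 1 := by
        rcases Int.units_eq_one_or u with rfl | rfl <;> simp
      rw [hw', map_add, map_mul, map_mul, map_pow, map_intCast]
      refine (norm_add_le _ _).trans ?_
      rw [norm_mul, norm_mul, hu, one_mul, norm_pow]
      have hpow : ‖φ γ‖ ^ m ≤ ‖φ γ‖ := pow_le_of_le_one (norm_nonneg _) hφ.le (by omega)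
      have hb := ihb ⟨z, hzK⟩ rfl
      have he' := hM₁ ⟨e, hEK e he⟩ he
      have h2 : ‖φ γ‖ ^ m * ‖φ ⟨z, hzK⟩‖ ≤ ‖φ γ‖ * (M₁ / (1 - ‖φ γ‖)) := by gcongr
      have h3 : ‖φ γ‖ * (M₁ / (1 - ‖φ γ‖)) + M₁ = M₁ / (1 - ‖φ γ‖) := by
        field_simp
        ring
      linarith
  exact hK.2

/-- Multiplication by `±β^m` preserves integrality, so the denominator `β^k` that serves `E` serves
every reachable value. -/
lemma AffineReach.mem_and_isIntegral {β : ℝ} (hint : IsIntegral ℤ β) {E : Set ℝ}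
    {K : Subfield ℝ} (hβK : β ∈ K) {k : ℕ} (hE : ∀ e ∈ E, e ∈ K ∧ IsIntegral ℤ (β ^ k * e))
    {z : ℝ} (hz : AffineReach β E z) : z ∈ K ∧ IsIntegral ℤ (β ^ k * z) := by
  induction hz with
  | base e he => exact hE e he
  | step z e u m hz he hm ih =>
    refine ⟨add_mem (mul_mem (mul_mem (intCast_mem _ _) (pow_mem hβK m)) ih.1) (hE e he).1, ?_⟩
    have : β ^ k * (((u : ℤ) : ℝ) * β ^ m * z + e)
        = (algebraMap ℤ ℝ u * β ^ m) * (β ^ k * z) + β ^ k * e := by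
      simp only [eq_intCast]; ring
    rw [this]
    exact ((isIntegral_algebraMap.mul (hint.pow m)).mul ih.2).add (hE e he).2

open IntermediateField in
/-- For a Pisot number, only finitely many reachable values lie in a bounded set. -/
theorem IsPisot.finite_affineReach {β : ℝ} (hβ : IsPisot β) {E : Set ℝ} (hE : E.Finite)
    (hEβ : ∀ e ∈ E, e ∈ Algebra.adjoin ℤ ({β, β⁻¹} : Set ℝ)) (B : ℝ) :
    {z | AffineReach β E z ∧ |z| ≤ B}.Finite := by
  obtain ⟨hint, h1, hconj⟩ := hβ
  have hβ0 : β ≠ 0 := by linarith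
  have hintQ : IsIntegral ℚ β := hint.tower_top
  have : FiniteDimensional ℚ ℚ⟮β⟯ := adjoin.finiteDimensional hintQ
  have : NumberField ℚ⟮β⟯ := ⟨⟩
  set γ := AdjoinSimple.gen ℚ β with hγ
  have hgen : (γ : ℝ) = β := AdjoinSimple.coe_gen ℚ β
  obtain ⟨k, hk⟩ : ∃ k : ℕ, ∀ e ∈ E, e ∈ ℚ⟮β⟯ ∧ IsIntegral ℤ (β ^ k * e) := by
    have hex := fun e : E => (mem_adjoin_and_isIntegral_pow_mul hint hβ0 (hEβ e e.2)).2
    choose k hk using hex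
    have := hE.to_subtype
    obtain ⟨k₀, hk₀⟩ := (Set.finite_range k).bddAbove
    refine ⟨k₀, fun e he => ⟨(mem_adjoin_and_isIntegral_pow_mul hint hβ0 (hEβ e he)).1, ?_⟩⟩
    have hle : k ⟨e, he⟩ ≤ k₀ := hk₀ ⟨_, rfl⟩
    have : β ^ k₀ * e = β ^ (k₀ - k ⟨e, he⟩) * (β ^ k ⟨e, he⟩ * e) := by
      rw [← mul_assoc, ← pow_add, Nat.sub_add_cancel hle]
    rw [this]
    exact (hint.pow _).mul (hk ⟨e, he⟩)
  have hbound : ∀ φ : ℚ⟮β⟯ →+* ℂ, ∃ M : ℝ, ∀ z, AffineReach β E z → |z| ≤ B →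
      ∀ w : ℚ⟮β⟯, (w : ℝ) = z → ‖φ w‖ ≤ M := by
    intro φ
    by_cases hφ : φ γ = (β : ℂ)
    -- An embedding fixing `β` is the inclusion, where the assumed bound on `|z|` applies; all other
    -- embeddings contract.
    · have hext : φ.toRatAlgHom = (Complex.ofRealHom.comp ℚ⟮β⟯.val.toRingHom).toRatAlgHom := by
        apply adjoin_algHom_ext
        intro x hx
        rw [Set.mem_singleton_iff] at hx
        subst hx
        exact hφ
      refine ⟨B, fun z _ hzB w hw => ?_⟩
      have : φ w = ((w : ℝ) : ℂ) := DFunLike.congr_fun hext w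
      rw [this, hw, Complex.norm_real]
      exact hzB
    · have hroot : Polynomial.aeval (φ γ) (minpoly ℚ β) = 0 := by
        have h2 : Polynomial.aeval γ (minpoly ℚ β) = 0 := by
          rw [hγ, ← minpoly_gen]
          exact minpoly.aeval _ _
        have h3 := Polynomial.aeval_algHom_apply φ.toRatAlgHom γ (minpoly ℚ β)
        rw [h2, map_zero] at h3
        exact h3
      obtain ⟨M, hM⟩ := AffineReach.exists_norm_le hE (fun e he => (hk e he).1) φ
        (hconj _ hroot hφ)
      exact ⟨M, fun z hz _ => hM z hz⟩
  choose M hM using hbound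
  obtain ⟨M₀, hM₀⟩ := (Set.finite_range fun φ : ℚ⟮β⟯ →+* ℂ => ‖φ γ‖ ^ k * M φ).bddAbove
  -- Finitely many algebraic integers of the field have all conjugates bounded; this is applied to
  -- `β^k z`.
  have hfin := NumberField.Embeddings.finite_of_norm_le ℚ⟮β⟯ ℂ M₀
  refine (hfin.image fun w : ℚ⟮β⟯ => β⁻¹ ^ k * (w : ℝ)).subset ?_
  rintro z ⟨hz, hzB⟩
  obtain ⟨hzK, hzint⟩ := hz.mem_and_isIntegral hint (K := ℚ⟮β⟯.toSubfield)
    (mem_adjoin_simple_self ℚ β) hk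
  refine ⟨γ ^ k * ⟨z, hzK⟩, ⟨?_, fun φ => ?_⟩, ?_⟩
  · refine (isIntegral_algHom_iff (ℚ⟮β⟯.val.restrictScalars ℤ) Subtype.val_injective).1 ?_
    simpa [hgen] using hzint
  · rw [map_mul, map_pow, norm_mul, norm_pow]
    refine le_trans ?_ (hM₀ ⟨φ, rfl⟩)
    exact mul_le_mul_of_nonneg_left (hM φ z hz hzB ⟨z, hzK⟩ rfl) (by positivity)
  · simp only [MulMemClass.coe_mul, SubmonoidClass.coe_pow, hgen]
    rw [← mul_assoc, ← mul_pow, inv_mul_cancel₀ hβ0, one_pow, one_mul]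

/-! ### The beta transformation -/

lemma coe_betaMap (β : ℝ) (x : I) : (betaMap β x : ℝ) = Int.fract (β * x) := rfl

lemma betaMap_eq_sub {β : ℝ} {x : I} {d : ℤ} (h1 : (d : ℝ) ≤ β * x) (h2 : β * x < d + 1) :
    (betaMap β x : ℝ) = β * x - d := by
  rw [coe_betaMap, Int.fract, Int.floor_eq_iff.2 ⟨h1, h2⟩]

lemma tameMap_betaMap {β : ℝ} (hβ : 1 < β) : TameMap (betaMap β) := by
  have hβ0 : β ≠ 0 := by linarith
  refine ⟨?_, ?_, fun a => ?_⟩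
  · exact Measurable.subtype_mk (measurable_fract.comp (by fun_prop))
  · refine measure_mono_null ?_ ((((Set.countable_range fun k : ℤ => (k : ℝ) / β).preimage
      Subtype.val_injective)).measure_zero volume)
    intro x hx
    by_contra hne
    apply hx
    have hk : β * (x : ℝ) ≠ ⌊β * (x : ℝ)⌋ := fun hk =>
      hne ⟨⌊β * (x : ℝ)⌋, by simp only; rw [← hk, mul_div_cancel_left₀ _ hβ0]⟩
    exact IsInducing.subtypeVal.continuousAt_iff.2
      (ContinuousAt.comp (f := fun y : I => β * (y : ℝ)) (continuousAt_fract hk) (by fun_prop))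
  · refine ((((Set.countable_range fun k : ℤ => (((a : ℝ) + k) / β)).preimage
      Subtype.val_injective)).mono ?_).measure_zero volume
    rintro x rfl
    refine ⟨⌊β * (x : ℝ)⌋, ?_⟩
    simp only [coe_betaMap, Int.fract_add_floor]
    rw [mul_div_cancel_left₀ _ hβ0]

lemma betaMap_iterate_of_lt {β : ℝ} (hβ : 1 < β) (k : ℕ) (x : I) (hx : (x : ℝ) * β ^ k < 1) :
    ((betaMap β)^[k] x : ℝ) = β ^ k * x := by
  induction k with
  | zero => simp
  | succ k ih =>
    have h0 : (0 : ℝ) ≤ x := x.2.1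
    have hp : 0 < β ^ k := by positivity
    have hlt : (x : ℝ) * β ^ k < 1 := by
      refine lt_of_le_of_lt ?_ hx
      rw [pow_succ]
      nlinarith [mul_nonneg h0 hp.le]
    have ih := ih hlt
    rw [Function.iterate_succ_apply', betaMap_eq_sub (d := 0), ih]
    · push_cast; ring
    · rw [ih]; push_cast; positivity
    · rw [ih]; push_cast; rw [pow_succ] at hx; linarith

/-- The orbit of 1 is reachable by steps `z ↦ β z - d` with integer digits and stays in `[0, 1]`, so
it is finite. -/
lemma IsPisot.exists_pos_le_betaMap_iterate_one {β : ℝ} (hβ : IsPisot β) :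
    ∃ c : ℝ, 0 < c ∧ ∀ n, 0 < ((betaMap β)^[n] 1 : ℝ) → c ≤ ((betaMap β)^[n] 1 : ℝ) := by
  have h1 := hβ.2.1
  set E : Set ℝ := (fun n : ℤ => (n : ℝ)) '' Set.Icc (-⌊β⌋) 1 with hE
  have hfin := hβ.finite_affineReach (E := E) ((Set.finite_Icc _ _).image _) (by
    rintro _ ⟨n, _, rfl⟩
    exact intCast_mem _ n) 1
  have hreach : ∀ n, AffineReach β E ((betaMap β)^[n] 1 : I) := by
    intro n
    induction n with
    | zero => exact AffineReach.base _ ⟨1, ⟨by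
        have : (0 : ℤ) ≤ ⌊β⌋ := Int.floor_nonneg.2 (by linarith)
        omega, le_rfl⟩, by simp⟩
    | succ n ih =>
      rw [Function.iterate_succ_apply']
      generalize (betaMap β)^[n] 1 = x at ih ⊢
      have hx0 : (0 : ℝ) ≤ x := x.2.1
      have hx1 : (x : ℝ) ≤ 1 := x.2.2
      have := AffineReach.step (x : ℝ) ((-⌊β * (x : ℝ)⌋ : ℤ) : ℝ) 1 1 ih ⟨-⌊β * (x : ℝ)⌋, ⟨?_, ?_⟩, rfl⟩
        le_rfl
      · convert this using 1
        rw [coe_betaMap, Int.fract]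
        push_cast
        ring
      · have : ⌊β * (x : ℝ)⌋ ≤ ⌊β⌋ := Int.floor_le_floor (by nlinarith)
        omega
      · have : 0 ≤ ⌊β * (x : ℝ)⌋ := Int.floor_nonneg.2 (by positivity)
        omega
  have hO : (Set.range fun n => ((betaMap β)^[n] 1 : ℝ)).Finite := by
    refine hfin.subset ?_
    rintro _ ⟨n, rfl⟩
    refine ⟨hreach n, ?_⟩
    rw [abs_of_nonneg ((betaMap β)^[n] 1).2.1]
    exact ((betaMap β)^[n] 1).2.2
  obtain ⟨c, ⟨hc1, hc2⟩, hc3⟩ := Set.exists_min_image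
    ({y | 0 < y} ∩ Set.range fun n => ((betaMap β)^[n] 1 : ℝ)) id (hO.inter_of_right _)
    ⟨1, by simp, 0, by simp⟩
  exact ⟨c, hc1, fun n hn => hc3 _ ⟨hn, n, rfl⟩⟩

/-- Every point of `[0, 1)` lies in a half-open interval on which `T ^ n` is affine and whose image
is `[0, s)` with `s` in the orbit of `1`. -/
lemma exists_betaMap_iterate_branch {β : ℝ} (hβ : 1 < β) (x : I) (hx : (x : ℝ) < 1) (n : ℕ) :
    ∃ (u : ℝ) (k : ℕ), 0 < ((betaMap β)^[k] 1 : ℝ) ∧ 0 ≤ u ∧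
      u + ((betaMap β)^[k] 1 : ℝ) / β ^ n ≤ 1 ∧ u ≤ x ∧
      (x : ℝ) < u + ((betaMap β)^[k] 1 : ℝ) / β ^ n ∧
      ∀ y : I, u ≤ y → (y : ℝ) < u + ((betaMap β)^[k] 1 : ℝ) / β ^ n →
        ((betaMap β)^[n] y : ℝ) = β ^ n * (y - u) := by
  induction n with
  | zero => exact ⟨0, 0, by simp, le_rfl, by simp, x.2.1, by simpa using hx, by simp⟩
  | succ n ih =>
    obtain ⟨u, k, hs, hu0, hu1, hux, hxu, haff⟩ := ih
    have hp : 0 < β ^ n := by positivity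
    have hp' : 0 < β ^ (n + 1) := by positivity
    have hβ0 : 0 < β := by linarith
    set s : ℝ := ((betaMap β)^[k] 1 : ℝ) with hsdef
    have hTx := haff x hux hxu
    set y : ℝ := β ^ n * (x - u) with hy
    have hy0 : 0 ≤ y := mul_nonneg hp.le (by linarith)
    have hys : y < s := by
      have : (x : ℝ) - u < s / β ^ n := by linarith
      rw [lt_div_iff₀ hp] at this
      linarith
    set d : ℤ := ⌊β * y⌋ with hd
    have hd0 : (0 : ℝ) ≤ d := by exact_mod_cast Int.floor_nonneg.2 (by positivity)
    have hd1 : (d : ℝ) ≤ β * y := Int.floor_le _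
    have hd2 : β * y < d + 1 := Int.lt_floor_add_one _
    have hxy : (x : ℝ) = u + y / β ^ n := by rw [hy]; field_simp; ring
    have main : ∀ s' : ℝ, s' ≤ 1 → d + s' ≤ β * s → β * y < d + s' →
        0 ≤ u + d / β ^ (n + 1) ∧ u + d / β ^ (n + 1) + s' / β ^ (n + 1) ≤ 1 ∧
        u + d / β ^ (n + 1) ≤ x ∧ (x : ℝ) < u + d / β ^ (n + 1) + s' / β ^ (n + 1) ∧
        ∀ z : I, u + d / β ^ (n + 1) ≤ z → (z : ℝ) < u + d / β ^ (n + 1) + s' / β ^ (n + 1) →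
          ((betaMap β)^[n + 1] z : ℝ) = β ^ (n + 1) * (z - (u + d / β ^ (n + 1))) := by
      intro s' hs1 hs2 hs3
      have hle : u + d / β ^ (n + 1) + s' / β ^ (n + 1) ≤ u + s / β ^ n := by
        rw [add_assoc, ← add_div, add_le_add_iff_left, div_le_div_iff₀ hp' hp, pow_succ]
        nlinarith
      have hdu : 0 ≤ d / β ^ (n + 1) := by positivity
      refine ⟨by positivity, hle.trans hu1, ?_, ?_, ?_⟩
      · rw [hxy, add_le_add_iff_left, div_le_div_iff₀ hp' hp, pow_succ]
        nlinarith
      · rw [hxy, add_assoc, ← add_div, add_lt_add_iff_left, div_lt_div_iff₀ hp hp', pow_succ]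
        nlinarith
      · intro z hz1 hz2
        have hz := haff z (by linarith) (by linarith)
        have e1 : β * (β ^ n * ((z : ℝ) - u)) = β ^ (n + 1) * (z - (u + d / β ^ (n + 1))) + d := by
          field_simp
          ring
        have e2 : 0 ≤ β ^ (n + 1) * ((z : ℝ) - (u + d / β ^ (n + 1))) :=
          mul_nonneg hp'.le (by linarith)
        have e3 : β ^ (n + 1) * ((z : ℝ) - (u + d / β ^ (n + 1))) < s' := by
          have : (z : ℝ) - (u + d / β ^ (n + 1)) < s' / β ^ (n + 1) := by linarith
          rw [lt_div_iff₀ hp'] at this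
          linarith
        rw [Function.iterate_succ_apply', betaMap_eq_sub (d := d), hz, e1]
        · ring
        · rw [hz, e1]; linarith
        · rw [hz, e1]; linarith
    -- If the digit interval fits entirely below `β s`, its image is `[0, 1)` and the orbit index
    -- restarts at 0. Otherwise it is the truncated last piece, with image `[0, T s)`.
    by_cases hcase : (d : ℝ) + 1 ≤ β * s
    · exact ⟨u + d / β ^ (n + 1), 0, by simp, by simpa using main 1 le_rfl hcase hd2⟩
    · push Not at hcase
      have hlast : ((betaMap β)^[k + 1] 1 : ℝ) = β * s - d := by
        rw [Function.iterate_succ_apply', betaMap_eq_sub (d := d)]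
        · nlinarith
        · exact hcase
      have hβys : β * y < β * s := by nlinarith
      refine ⟨u + d / β ^ (n + 1), k + 1, by rw [hlast]; linarith, ?_⟩
      rw [hlast]
      exact main _ (by linarith) (by linarith) (by linarith)

/-- A branch of `T^n` need not be full, but its image `[0, s)` contains `[0, β^(-k))` for a fixed
`k`, and `T^k` maps that onto `[0, 1)`. So the initial part of the branch, of length `β^(-(k+n))`,
is full for `T^(k+n)`. It may miss `x`, but the distance is comparable to its length, whence the
constant `2 * β ^ k`. -/
theorem IsPisot.zeroOneLaw_betaMap {β : ℝ} (hβ : IsPisot β) : ZeroOneLaw (betaMap β) := by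
  have h1 := hβ.2.1
  obtain ⟨c, hc, hcO⟩ := hβ.exists_pos_le_betaMap_iterate_one
  obtain ⟨k, hk⟩ : ∃ k : ℕ, (β⁻¹) ^ k < c := exists_pow_lt_of_lt_one hc (inv_lt_one_of_one_lt₀ h1)
  intro A hA hinv hpos
  refine measure_compl_eq_zero_of_fullBranch (2 * β ^ k) ?_ hA hinv hpos
  have hae : ∀ᵐ x : I, x ≠ 1 := by simp [ae_iff]
  filter_upwards [hae] with x hx ε hε
  have hx1 : (x : ℝ) < 1 := lt_of_le_of_ne x.2.2 fun h => hx (Subtype.ext h)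
  obtain ⟨n, hn⟩ : ∃ n : ℕ, (β⁻¹) ^ n < ε := exists_pow_lt_of_lt_one hε (inv_lt_one_of_one_lt₀ h1)
  obtain ⟨u, j, hs, hu0, hu1, hux, hxu, haff⟩ := exists_betaMap_iterate_branch h1 x hx1 n
  have hcs := hcO j hs
  have hs1 : ((betaMap β)^[j] 1 : ℝ) ≤ 1 := ((betaMap β)^[j] 1).2.2
  set s : ℝ := ((betaMap β)^[j] 1 : ℝ)
  have hp : 0 < β ^ n := by positivity
  have hq : 0 < β ^ k := by positivity
  have hq1 : 1 ≤ β ^ k := one_le_pow₀ h1.le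
  have hks : (β ^ k)⁻¹ ≤ s := by rw [← inv_pow]; linarith
  have hlen : (β ^ (k + n))⁻¹ ≤ s / β ^ n := by
    rw [pow_add, mul_inv, ← div_eq_mul_inv]
    gcongr
  have hlen2 : s / β ^ n ≤ β ^ k * (β ^ (k + n))⁻¹ := by
    rw [pow_add, mul_inv, ← mul_assoc, mul_inv_cancel₀ hq.ne', one_mul, ← one_div]
    gcongr
  have hpos2 : 0 < (β ^ (k + n))⁻¹ := by positivity
  refine ⟨k + n, u, u + (β ^ (k + n))⁻¹, β ^ (k + n), -(β ^ (k + n) * u),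
    ⟨hu0, by linarith, ?_, ?_⟩, ?_, ?_⟩
  · rw [abs_of_pos (by positivity), add_sub_cancel_left, mul_inv_cancel₀ (by positivity)]
  · intro y hy1 hy2
    have hy := haff y hy1.le (by linarith)
    have hlt : ((betaMap β)^[n] y : ℝ) * β ^ k < 1 := by
      rw [hy]
      have : (y : ℝ) - u < (β ^ (k + n))⁻¹ := by linarith
      rw [← one_div, lt_div_iff₀ (by positivity), pow_add] at this
      linarith
    rw [Function.iterate_add_apply, betaMap_iterate_of_lt h1 k _ hlt, hy]
    ring
  · rw [add_sub_cancel_left]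
    refine lt_of_le_of_lt ?_ hn
    rw [← inv_pow]
    exact pow_le_pow_of_le_one (by positivity) (inv_le_one_of_one_le₀ h1.le) (by omega)
  · have e1 : β ^ k * (β ^ (k + n))⁻¹ ≥ (β ^ (k + n))⁻¹ := by nlinarith
    rw [abs_le]
    constructor <;> nlinarith

/-! ### The invariant measure of the beta transformation -/

lemma measure_lt_inter_eq_add (B : Set I) (hB : MeasurableSet B) {p q : ℝ} (hpq : p ≤ q) :
    volume ({x : I | (x : ℝ) < q} ∩ B)
      = volume ({x : I | (x : ℝ) < p} ∩ B) + volume ({x : I | p < (x : ℝ) ∧ (x : ℝ) < q} ∩ B) := by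
  have hm : MeasurableSet ({x : I | p < (x : ℝ) ∧ (x : ℝ) < q} ∩ B) :=
    (measurable_subtype_coe measurableSet_Ioo).inter hB
  rw [← measure_union ?_ hm]
  · refine le_antisymm ?_ (measure_mono ?_)
    · have hsub : {x : I | (x : ℝ) < q} ∩ B ⊆ ({x : I | (x : ℝ) < p} ∩ B ∪
          {x : I | p < (x : ℝ) ∧ (x : ℝ) < q} ∩ B) ∪ Subtype.val ⁻¹' {p} := by
        rintro x ⟨hx, hxB⟩
        rcases lt_trichotomy (x : ℝ) p with h | h | h
        · exact Or.inl (Or.inl ⟨h, hxB⟩)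
        · exact Or.inr h
        · exact Or.inl (Or.inr ⟨⟨h, hx⟩, hxB⟩)
      refine (measure_mono hsub).trans ((measure_union_le _ _).trans ?_)
      have : volume ((Subtype.val : I → ℝ) ⁻¹' {p}) = 0 :=
        ((Set.countable_singleton p).preimage Subtype.val_injective).measure_zero _
      rw [this, add_zero]
    · rintro x (⟨hx, hxB⟩ | ⟨hx, hxB⟩)
      · exact ⟨lt_of_lt_of_le hx hpq, hxB⟩
      · exact ⟨hx.2, hxB⟩
  · rw [Set.disjoint_left]
    rintro x ⟨h1, _⟩ ⟨⟨h2, _⟩, _⟩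
    exact lt_asymm h1 h2

lemma measure_lt_zero_inter (B : Set I) : volume ({x : I | (x : ℝ) < 0} ∩ B) = 0 := by
  have : {x : I | (x : ℝ) < 0} ∩ B = ∅ := by
    ext x
    simp only [Set.mem_inter_iff, Set.mem_ofPred_eq, Set.mem_empty_iff_false, iff_false, not_and]
    exact fun h => absurd x.2.1 (not_le.2 h)
  rw [this, measure_empty]

lemma measure_betaMap_branch {β : ℝ} (hβ : 1 < β) (A : Set I) (hA : MeasurableSet A) (d : ℕ)
    {w : ℝ} (hw0 : 0 ≤ w) (hw : w ≤ 1) (hdw : d + w ≤ β) :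
    volume ({x : I | d / β < (x : ℝ) ∧ (x : ℝ) < (d + w) / β} ∩ betaMap β ⁻¹' A)
      = ENNReal.ofReal β⁻¹ * volume ({x : I | (x : ℝ) < w} ∩ A) := by
  have hβ0 : 0 < β := by linarith
  have h0 := measure_lt_inter_eq_add A hA hw0
  rw [measure_lt_zero_inter, zero_add] at h0
  rw [h0, volume_apply, volume_apply, ← abs_of_pos hβ0,
    ← volume_preimage_affine hβ0.ne' (-(d : ℝ)), abs_of_pos hβ0]
  congr 1
  have haff : ∀ x : I, d / β < (x : ℝ) → (x : ℝ) < (d + w) / β → (betaMap β x : ℝ) = β * x - d := by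
    intro x h1 h2
    rw [div_lt_iff₀ hβ0] at h1
    rw [lt_div_iff₀ hβ0] at h2
    rw [betaMap_eq_sub (d := d)] <;> push_cast <;> linarith
  ext x
  constructor
  · rintro ⟨y, ⟨⟨h1, h2⟩, h3⟩, rfl⟩
    have hy := haff y h1 h2
    rw [div_lt_iff₀ hβ0] at h1
    rw [lt_div_iff₀ hβ0] at h2
    refine ⟨betaMap β y, ⟨⟨?_, ?_⟩, h3⟩, ?_⟩
    · rw [hy]; linarith
    · rw [hy]; linarith
    · rw [hy]; ring
  · rintro ⟨y, ⟨⟨h1, h2⟩, h3⟩, h4⟩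
    simp only at h4
    have e1 : d / β < x := by rw [div_lt_iff₀ hβ0]; linarith
    have e2 : x < (d + w) / β := by rw [lt_div_iff₀ hβ0]; linarith
    have e3 : (0 : ℝ) ≤ d / β := by positivity
    have e4 : (d + w) / β ≤ 1 := by rw [div_le_one hβ0]; exact hdw
    refine ⟨⟨x, by linarith, by linarith⟩, ⟨⟨e1, e2⟩, ?_⟩, rfl⟩
    have : betaMap β ⟨x, by linarith, by linarith⟩ = y :=
      Subtype.ext ((haff _ e1 e2).trans (by simp only; linarith))
    rwa [Set.mem_preimage, this]

lemma measure_lt_one_inter (B : Set I) (hB : MeasurableSet B) :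
    volume ({x : I | (x : ℝ) < 1} ∩ B) = volume B := by
  rw [measure_lt_inter_eq_add B hB zero_le_one, measure_lt_zero_inter, zero_add, Set.inter_comm,
    unitInterval.measure_inter_Ioo]

/-- The transfer operator of the beta transformation on indicators of intervals `[0, s)`. -/
lemma measure_lt_inter_preimage_betaMap {β : ℝ} (hβ : 1 < β) (A : Set I) (hA : MeasurableSet A)
    (s : I) :
    volume ({x : I | x < s} ∩ betaMap β ⁻¹' A) = ENNReal.ofReal β⁻¹ *
      (⌊β * (s : ℝ)⌋₊ * volume A + volume ({x : I | x < betaMap β s} ∩ A)) := by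
  have hβ0 : 0 < β := by linarith
  have hmeas : MeasurableSet (betaMap β ⁻¹' A) := (tameMap_betaMap hβ).measurable hA
  have hint : ∀ d : ℕ, (d : ℝ) ≤ β →
      volume ({x : I | (x : ℝ) < d / β} ∩ betaMap β ⁻¹' A)
        = ENNReal.ofReal β⁻¹ * (d * volume A) := by
    intro d
    induction d with
    | zero => intro _; simpa using measure_lt_zero_inter (betaMap β ⁻¹' A)
    | succ d ih =>
      intro hd
      push_cast at hd ⊢
      have hle : (d : ℝ) / β ≤ (d + 1) / β := by gcongr; linarith
      rw [measure_lt_inter_eq_add _ hmeas hle, ih (by linarith),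
        measure_betaMap_branch hβ A hA d zero_le_one le_rfl hd, measure_lt_one_inter A hA]
      ring
  have hs0 : 0 ≤ β * (s : ℝ) := mul_nonneg hβ0.le s.2.1
  have hsβ : β * (s : ℝ) ≤ β := by nlinarith [s.2.2]
  have hfloor : ((⌊β * (s : ℝ)⌋₊ : ℕ) : ℝ) ≤ β * s := Nat.floor_le hs0
  have hT : (betaMap β s : ℝ) = β * s - ⌊β * (s : ℝ)⌋₊ := by
    rw [coe_betaMap, Int.fract, natCast_floor_eq_intCast_floor hs0]
  have hs : (s : ℝ) = (⌊β * (s : ℝ)⌋₊ + (betaMap β s : ℝ)) / β := by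
    rw [hT]; field_simp; ring
  have e1 : {x : I | x < s} = {x : I | (x : ℝ) < (⌊β * (s : ℝ)⌋₊ + (betaMap β s : ℝ)) / β} := by
    rw [← hs]; rfl
  have e2 : {x : I | x < betaMap β s} = {x : I | (x : ℝ) < (betaMap β s : ℝ)} := rfl
  have hle : (⌊β * (s : ℝ)⌋₊ : ℝ) / β ≤ (⌊β * (s : ℝ)⌋₊ + (betaMap β s : ℝ)) / β := by
    gcongr; linarith [(betaMap β s).2.1]
  rw [e1, e2, measure_lt_inter_eq_add _ hmeas hle, hint _ (by linarith),
    measure_betaMap_branch hβ A hA _ (betaMap β s).2.1 (betaMap β s).2.2 (by linarith), mul_add]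

/-- The greedy digits of one sum to one. -/
lemma tsum_digits_one {β : ℝ} (hβ : 1 < β) :
    ∑' n : ℕ, ENNReal.ofReal β⁻¹ ^ (n + 1) * (⌊β * ((betaMap β)^[n] 1 : ℝ)⌋₊ : ENNReal) = 1 := by
  have hβ0 : 0 < β := by linarith
  have hsum : HasSum (fun n : ℕ => β⁻¹ ^ (n + 1) * (⌊β * ((betaMap β)^[n] 1 : ℝ)⌋₊ : ℝ)) 1 := by
    rw [hasSum_iff_tendsto_nat_of_nonneg (fun n => by positivity)]
    have hpart : ∀ N : ℕ, ∑ n ∈ Finset.range N, β⁻¹ ^ (n + 1) * (⌊β * ((betaMap β)^[n] 1 : ℝ)⌋₊ : ℝ)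
        = 1 - β⁻¹ ^ N * ((betaMap β)^[N] 1 : ℝ) := by
      intro N
      induction N with
      | zero => simp
      | succ N ih =>
        rw [Finset.sum_range_succ, ih, Function.iterate_succ_apply', coe_betaMap, Int.fract,
          natCast_floor_eq_intCast_floor (mul_nonneg hβ0.le ((betaMap β)^[N] 1).2.1), pow_succ]
        field_simp
        ring
    simp only [hpart]
    have hz : Tendsto (fun N : ℕ => β⁻¹ ^ N * ((betaMap β)^[N] 1 : ℝ)) atTop (𝓝 0) := by
      refine squeeze_zero (fun N => mul_nonneg (by positivity) ((betaMap β)^[N] 1).2.1) (fun N => ?_)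
        (tendsto_pow_atTop_nhds_zero_of_lt_one (inv_nonneg.2 hβ0.le) (inv_lt_one_of_one_lt₀ hβ))
      exact mul_le_of_le_one_right (by positivity) ((betaMap β)^[N] 1).2.2
    simpa using hz.const_sub 1
  have h2 := ENNReal.ofReal_tsum_of_nonneg (fun n => by positivity) hsum.summable
  rw [hsum.tsum_eq, ENNReal.ofReal_one] at h2
  rw [h2]
  congr 1
  ext n
  rw [ENNReal.ofReal_mul (by positivity), ENNReal.ofReal_pow (by positivity), ENNReal.ofReal_natCast]

/-- The beta transformation has an absolutely continuous invariant probability measure with bounded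
density. -/
theorem exists_isACIP_betaMap {β : ℝ} (hβ : 1 < β) :
    ∃ (μ : Measure I) (C : ℝ), 0 ≤ C ∧ IsACIP (betaMap β) μ ∧
      ∀ A, μ A ≤ ENNReal.ofReal C * volume A := by
  have hβ0 : 0 < β := by linarith
  have hT := (tameMap_betaMap hβ).measurable
  set b : ENNReal := ENNReal.ofReal β⁻¹ with hb
  have hb1 : b < 1 := by
    rw [hb, ENNReal.ofReal_lt_one]; exact inv_lt_one_of_one_lt₀ hβ
  set D : ENNReal := (1 - b)⁻¹ with hD
  have hDtop : D ≠ ⊤ := ENNReal.inv_ne_top.2 (tsub_pos_of_lt hb1).ne'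
  -- Parry's density, before normalisation: the sum over `n` of `β^(-n)` times the indicator of `[0,
  -- T^n 1)`. It is bounded by the geometric sum `D`.
  set ρ : Measure I := Measure.sum fun n : ℕ =>
    b ^ n • volume.restrict {x : I | x < (betaMap β)^[n] 1} with hρ
  have happ : ∀ A, MeasurableSet A →
      ρ A = ∑' n : ℕ, b ^ n * volume ({x : I | x < (betaMap β)^[n] 1} ∩ A) := by
    intro A hA
    rw [hρ, Measure.sum_apply _ hA]
    congr 1
    ext n
    rw [Measure.smul_apply, Measure.restrict_apply hA, Set.inter_comm, smul_eq_mul]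
  have hle : ρ ≤ D • (volume : Measure I) := by
    refine Measure.le_iff.2 fun A hA => ?_
    rw [happ A hA, Measure.smul_apply, smul_eq_mul, hD, ← ENNReal.tsum_geometric,
      ← ENNReal.tsum_mul_right]
    exact ENNReal.tsum_le_tsum fun n => mul_le_mul_right (measure_mono Set.inter_subset_right) _
  have hone : ∀ A, MeasurableSet A → volume ({x : I | x < (betaMap β)^[0] 1} ∩ A) = volume A :=
    fun A hA => measure_lt_one_inter A hA
  have hinv : ∀ A, MeasurableSet A → ρ (betaMap β ⁻¹' A) = ρ A := by
    intro A hA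
    rw [happ _ (hT hA), happ A hA, tsum_eq_zero_add' (f := fun n : ℕ =>
      b ^ n * volume ({x : I | x < (betaMap β)^[n] 1} ∩ A)) ENNReal.summable, pow_zero, one_mul,
      hone A hA]
    -- Each term of the preimage sum yields the next term of the original sum plus a digit times
    -- `volume A`. The weighted digits sum to 1, which restores the missing term `n = 0`.
    have : ∀ n : ℕ, b ^ n * volume ({x : I | x < (betaMap β)^[n] 1} ∩ betaMap β ⁻¹' A)
        = (b ^ (n + 1) * (⌊β * ((betaMap β)^[n] 1 : ℝ)⌋₊ : ENNReal)) * volume A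
          + b ^ (n + 1) * volume ({x : I | x < (betaMap β)^[n + 1] 1} ∩ A) := by
      intro n
      rw [measure_lt_inter_preimage_betaMap hβ A hA, Function.iterate_succ_apply', ← hb]
      ring
    simp only [this]
    rw [ENNReal.tsum_add, ENNReal.tsum_mul_right, hb, tsum_digits_one hβ, one_mul]
  have huniv1 : 1 ≤ ρ Set.univ := by
    rw [happ _ MeasurableSet.univ]
    refine le_trans ?_ (ENNReal.le_tsum 0)
    rw [hone _ MeasurableSet.univ, pow_zero, one_mul, measure_univ]
  have hunivtop : ρ Set.univ ≠ ⊤ := by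
    refine ((hle Set.univ).trans_lt ?_).ne
    simpa using hDtop.lt_top
  have hbound : ∀ A, ((ρ Set.univ)⁻¹ • ρ) A ≤ ENNReal.ofReal D.toReal * volume A := by
    intro A
    rw [ENNReal.ofReal_toReal hDtop, Measure.smul_apply, smul_eq_mul]
    refine (mul_le_of_le_one_left zero_le (ENNReal.inv_le_one.2 huniv1)).trans ?_
    exact hle A
  refine ⟨(ρ Set.univ)⁻¹ • ρ, D.toReal, ENNReal.toReal_nonneg, ⟨⟨?_⟩, ?_, ?_⟩, hbound⟩
  · rw [Measure.smul_apply, smul_eq_mul]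
    exact ENNReal.inv_mul_cancel (one_pos.trans_le huniv1).ne' hunivtop
  · intro A hA
    exact le_antisymm ((hbound A).trans (by rw [hA, mul_zero])) zero_le
  · refine MeasurePreserving.smul_measure ⟨hT, ?_⟩ _
    ext A hA
    rw [Measure.map_apply hT hA, hinv A hA]

/-! ### Structure and ergodicity of the maps built from expressions of one -/

namespace LurothMap

variable {β : ℝ} {a : ℕ →₀ ℕ} (S : LurothMap β a)

lemma one_le_m (ha : a ∈ unitExpressions β) (k : Fin S.N) : 1 ≤ S.m k := by
  by_contra! h
  have h0 : S.m k = 0 := by omega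
  have hc := S.card_eq 0
  rw [ha.1, Finset.card_eq_zero] at hc
  have : k ∈ Finset.univ.filter fun k : Fin S.N => S.m k = 0 := by simp [h0]
  rw [hc] at this
  simp at this

lemma fullBranch (hβ : 1 < β) (k : Fin S.N) :
    FullBranch S.toFun (S.t k.castSucc) (S.t k.succ) (((S.sign k : ℤ) : ℝ) * β ^ S.m k)
      (S.intercept k) where
  nonneg := (S.t _).2.1
  le_one := (S.t _).2.2
  slope := by
    have h1 : |((S.sign k : ℤ) : ℝ)| = 1 := by
      rcases Int.units_eq_one_or (S.sign k) with h | h <;> simp [h]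
    rw [S.length_eq, abs_mul, h1, one_mul, abs_of_pos (by positivity),
      mul_inv_cancel₀ (by positivity)]
  affine := fun x h1 h2 => S.affine k x ⟨h1, h2⟩

lemma t_lt_succ (hβ : 1 < β) (k : Fin S.N) : S.t k.castSucc < S.t k.succ :=
  (S.fullBranch hβ k).lt

lemma t_strictMono (hβ : 1 < β) : StrictMono S.t :=
  Fin.strictMono_iff_lt_succ.2 (S.t_lt_succ hβ)

lemma mem_Ioo_or_eq (x : I) :
    (∃ k : Fin S.N, x ∈ Set.Ioo (S.t k.castSucc) (S.t k.succ)) ∨ ∃ j, x = S.t j := by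
  have key : ∀ j : Fin (S.N + 1), x ≤ S.t j →
      (∃ k : Fin S.N, x ∈ Set.Ioo (S.t k.castSucc) (S.t k.succ)) ∨ ∃ j, x = S.t j := by
    intro j
    induction j using Fin.induction with
    | zero =>
      intro h
      exact Or.inr ⟨0, le_antisymm h (by rw [S.t_zero]; exact x.2.1)⟩
    | succ k ih =>
      intro h
      by_cases h1 : x ≤ S.t k.castSucc
      · exact ih h1
      · rcases h.eq_or_lt with h2 | h2
        · exact Or.inr ⟨_, h2⟩
        · exact Or.inl ⟨k, not_le.1 h1, h2⟩
  exact key (Fin.last _) (by rw [S.t_last]; exact x.2.2)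

lemma N_pos : 0 < S.N := by
  by_contra! h
  have h0 : (Fin.last S.N) = 0 := by
    ext; simp; omega
  have h1 := S.t_last
  rw [h0, S.t_zero] at h1
  exact zero_ne_one h1

lemma exists_mem_Icc (hβ : 1 < β) (x : I) :
    ∃ k : Fin S.N, x ∈ Set.Icc (S.t k.castSucc) (S.t k.succ) := by
  rcases S.mem_Ioo_or_eq x with ⟨k, hk⟩ | ⟨j, rfl⟩
  · exact ⟨k, Set.Ioo_subset_Icc_self hk⟩
  · induction j using Fin.lastCases with
    | last =>
      have hN := S.N_pos
      refine ⟨⟨S.N - 1, by omega⟩, ?_⟩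
      have : (⟨S.N - 1, by omega⟩ : Fin S.N).succ = Fin.last S.N := by
        ext; simp only [Fin.succ_mk, Fin.val_last]; omega
      rw [← this]
      exact Set.right_mem_Icc.2 (S.t_lt_succ hβ _).le
    | cast k => exact ⟨k, Set.left_mem_Icc.2 (S.t_lt_succ hβ k).le⟩

/-- Matters at endpoints of the interval: there continuity forces the one-sided limit of the branch.
-/
lemma eq_affine_of_continuousAt (hβ : 1 < β) {x : I} {k : Fin S.N}
    (hx : x ∈ Set.Icc (S.t k.castSucc) (S.t k.succ)) (hc : ContinuousAt S.toFun x) :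
    (S.toFun x : ℝ) = ((S.sign k : ℤ) : ℝ) * β ^ S.m k * (x : ℝ) + S.intercept k := by
  rw [← closure_Ioo (S.t_lt_succ hβ k).ne, mem_closure_iff_nhdsWithin_neBot] at hx
  have h1 : Tendsto (fun y : I => (S.toFun y : ℝ)) (𝓝[Set.Ioo (S.t k.castSucc) (S.t k.succ)] x)
      (𝓝 (S.toFun x : ℝ)) :=
    ((continuous_subtype_val.tendsto _).comp hc).mono_left nhdsWithin_le_nhds
  have h2 : Continuous fun y : I => ((S.sign k : ℤ) : ℝ) * β ^ S.m k * (y : ℝ) + S.intercept k := by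
    fun_prop
  refine tendsto_nhds_unique h1 (((h2.tendsto x).mono_left nhdsWithin_le_nhds).congr' ?_)
  filter_upwards [self_mem_nhdsWithin] with y hy using (S.affine k y hy).symm

lemma affine_t_eq (hβ : 1 < β) {x : I} {k : Fin S.N}
    (hx : x = S.t k.castSucc ∨ x = S.t k.succ) :
    ((S.sign k : ℤ) : ℝ) * β ^ S.m k * (x : ℝ) + S.intercept k = 0 ∨
      ((S.sign k : ℤ) : ℝ) * β ^ S.m k * (x : ℝ) + S.intercept k = 1 := by
  rcases (S.fullBranch hβ k).endpoints with ⟨-, h0, h1⟩ | ⟨-, h0, h1⟩ <;>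
    rcases hx with rfl | rfl <;> simp_all

/-- Everywhere on the interval the map is affine up to an error in `{-1, 0, 1}`. -/
lemma exists_eq_affine_add (hβ : 1 < β) (x : I) :
    ∃ (k : Fin S.N) (e : ℤ), e ∈ Set.Icc (-1) 1 ∧
      (S.toFun x : ℝ) = ((S.sign k : ℤ) : ℝ) * β ^ S.m k * (x : ℝ) + (S.intercept k + e) := by
  obtain ⟨k, hk⟩ := S.exists_mem_Icc hβ x
  by_cases hc : ContinuousAt S.toFun x
  · exact ⟨k, 0, by simp, by rw [S.eq_affine_of_continuousAt hβ hk hc]; simp⟩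
  -- At a discontinuous endpoint both the value of `S` and that of the affine branch lie in `{0,
  -- 1}`, so their difference is -1, 0 or 1.
  rcases eq_or_lt_of_le hk.1 with h1 | h1
  · rcases S.affine_t_eq hβ (k := k) (Or.inl h1.symm) with h | h <;>
      rcases S.discontinuity x hc with h2 | h2
    · exact ⟨k, 0, by simp, by rw [h2, ← add_assoc, h]; simp⟩
    · exact ⟨k, 1, by simp, by rw [h2, ← add_assoc, h]; simp⟩
    · exact ⟨k, -1, by simp, by rw [h2, ← add_assoc, h]; simp⟩
    · exact ⟨k, 0, by simp, by rw [h2, ← add_assoc, h]; simp⟩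
  rcases eq_or_lt_of_le hk.2 with h3 | h3
  · rcases S.affine_t_eq hβ (k := k) (Or.inr h3) with h | h <;>
      rcases S.discontinuity x hc with h2 | h2
    · exact ⟨k, 0, by simp, by rw [h2, ← add_assoc, h]; simp⟩
    · exact ⟨k, 1, by simp, by rw [h2, ← add_assoc, h]; simp⟩
    · exact ⟨k, -1, by simp, by rw [h2, ← add_assoc, h]; simp⟩
    · exact ⟨k, 0, by simp, by rw [h2, ← add_assoc, h]; simp⟩
  · exact ⟨k, 0, by simp, by rw [S.affine k x ⟨h1, h3⟩]; simp⟩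

lemma t_mem_adjoin (j : Fin (S.N + 1)) :
    (S.t j : ℝ) ∈ Algebra.adjoin ℤ ({β, β⁻¹} : Set ℝ) := by
  induction j using Fin.induction with
  | zero => rw [S.t_zero]; exact zero_mem _
  | succ k ih =>
    have h := S.length_eq k
    rw [← inv_pow] at h
    rw [eq_add_of_sub_eq h]
    exact add_mem (pow_mem (Algebra.subset_adjoin (by simp)) _) ih

/-- The left endpoint, a sum of powers of `β⁻¹`, is sent to 0 or 1, and this determines the
intercept. -/
lemma intercept_mem_adjoin (hβ : 1 < β) (k : Fin S.N) :
    S.intercept k ∈ Algebra.adjoin ℤ ({β, β⁻¹} : Set ℝ) := by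
  have hr : ((S.sign k : ℤ) : ℝ) * β ^ S.m k * (S.t k.castSucc : ℝ) ∈
      Algebra.adjoin ℤ ({β, β⁻¹} : Set ℝ) :=
    mul_mem (mul_mem (intCast_mem _ _) (pow_mem (Algebra.subset_adjoin (by simp)) _))
      (S.t_mem_adjoin _)
  rcases S.affine_t_eq hβ (k := k) (Or.inl rfl) with h | h
  · rw [eq_sub_of_add_eq' h]
    exact sub_mem (zero_mem _) hr
  · rw [eq_sub_of_add_eq' h]
    exact sub_mem (one_mem _) hr

lemma measurable_toFun : Measurable S.toFun := by
  intro A hA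
  have hAm : MeasurableSet (Subtype.val '' A : Set ℝ) :=
    measurableEmbedding_coe.measurableSet_image' hA
  have : S.toFun ⁻¹' A = (⋃ k : Fin S.N, (Set.Ioo (S.t k.castSucc) (S.t k.succ) ∩
      (fun x : I => ((S.sign k : ℤ) : ℝ) * β ^ S.m k * (x : ℝ) + S.intercept k) ⁻¹'
        (Subtype.val '' A))) ∪ (Set.range S.t ∩ S.toFun ⁻¹' A) := by
    ext x
    simp only [Set.mem_union, Set.mem_iUnion, Set.mem_inter_iff, Set.mem_preimage]
    constructor
    · intro hx
      rcases S.mem_Ioo_or_eq x with ⟨k, hk⟩ | ⟨j, rfl⟩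
      · exact Or.inl ⟨k, hk, S.toFun x, hx, S.affine k x hk⟩
      · exact Or.inr ⟨⟨j, rfl⟩, hx⟩
    · rintro (⟨k, hk, y, hy, h⟩ | ⟨-, hx⟩)
      · rwa [show S.toFun x = y from Subtype.ext ((S.affine k x hk).trans h.symm)]
      · exact hx
  rw [this]
  refine (MeasurableSet.iUnion fun k => measurableSet_Ioo.inter ?_).union
    ((Set.finite_range S.t).inter_of_left _).measurableSet
  exact (by fun_prop : Measurable fun x : I =>
    ((S.sign k : ℤ) : ℝ) * β ^ S.m k * (x : ℝ) + S.intercept k) hAm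

lemma continuousAt_toFun {x : I} {k : Fin S.N}
    (hx : x ∈ Set.Ioo (S.t k.castSucc) (S.t k.succ)) : ContinuousAt S.toFun x := by
  rw [IsInducing.subtypeVal.continuousAt_iff]
  have h2 : Continuous fun y : I => ((S.sign k : ℤ) : ℝ) * β ^ S.m k * (y : ℝ) + S.intercept k := by
    fun_prop
  refine h2.continuousAt.congr ?_
  filter_upwards [isOpen_Ioo.mem_nhds hx] with y hy using (S.affine k y hy).symm

lemma measure_range_t : volume (Set.range S.t) = 0 := (Set.finite_range S.t).measure_zero _

lemma pairwise_disjoint_Ioo (hβ : 1 < β) :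
    Pairwise (Function.onFun Disjoint fun k : Fin S.N => Set.Ioo (S.t k.castSucc) (S.t k.succ)) := by
  have key : ∀ k l : Fin S.N, k < l →
      Disjoint (Set.Ioo (S.t k.castSucc) (S.t k.succ)) (Set.Ioo (S.t l.castSucc) (S.t l.succ)) := by
    intro k l hkl
    rw [Set.disjoint_left]
    intro x hx hx'
    have : S.t k.succ ≤ S.t l.castSucc :=
      (S.t_strictMono hβ).monotone (by rw [Fin.le_def]; simpa using hkl)
    exact absurd (hx.2.trans_le this) (not_lt.2 hx'.1.le)
  intro k l hkl
  rcases lt_or_gt_of_ne hkl with h | h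
  · exact key k l h
  · exact (key l k h).symm

lemma measure_eq_sum (hβ : 1 < β) {B : Set I} (hB : MeasurableSet B) :
    volume B = ∑ k : Fin S.N, volume (Set.Ioo (S.t k.castSucc) (S.t k.succ) ∩ B) := by
  rw [← tsum_fintype (L := .unconditional _), ← measure_iUnion]
  · refine le_antisymm ?_ (measure_mono (Set.iUnion_subset fun k => Set.inter_subset_right))
    have hsub : B ⊆ (⋃ k : Fin S.N, Set.Ioo (S.t k.castSucc) (S.t k.succ) ∩ B) ∪ Set.range S.t := by
      intro x hx
      rcases S.mem_Ioo_or_eq x with ⟨k, hk⟩ | ⟨j, rfl⟩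
      · exact Or.inl (Set.mem_iUnion.2 ⟨k, hk, hx⟩)
      · exact Or.inr ⟨j, rfl⟩
    refine (measure_mono hsub).trans ((measure_union_le _ _).trans ?_)
    rw [S.measure_range_t, add_zero]
  · intro k l hkl
    exact (S.pairwise_disjoint_Ioo hβ hkl).mono Set.inter_subset_left Set.inter_subset_left
  · exact fun k => measurableSet_Ioo.inter hB

lemma measurePreserving (hβ : 1 < β) : MeasurePreserving S.toFun volume volume := by
  have hbranch : ∀ (k : Fin S.N) (A : Set I),
      volume (Set.Ioo (S.t k.castSucc) (S.t k.succ) ∩ S.toFun ⁻¹' A)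
        = ENNReal.ofReal ((S.t k.succ : ℝ) - S.t k.castSucc) * volume A :=
    fun k A => (S.fullBranch hβ k).volume_inter_preimage A
  refine ⟨S.measurable_toFun, ?_⟩
  -- The branch formula applied to the whole space shows that the interval lengths sum to 1.
  have hone := S.measure_eq_sum hβ MeasurableSet.univ
  rw [← Set.preimage_univ (f := S.toFun)] at hone
  simp only [hbranch] at hone
  simp only [Set.preimage_univ, measure_univ, mul_one] at hone
  ext A hA
  rw [Measure.map_apply S.measurable_toFun hA, S.measure_eq_sum hβ (S.measurable_toFun hA)]
  simp only [hbranch]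
  rw [← Finset.sum_mul, ← hone, one_mul]

lemma tameMap (hβ : 1 < β) : TameMap S.toFun := by
  refine ⟨S.measurable_toFun, measure_mono_null ?_ S.measure_range_t, fun x => ?_⟩
  · intro x hx
    rcases S.mem_Ioo_or_eq x with ⟨k, hk⟩ | ⟨j, rfl⟩
    · exact absurd (S.continuousAt_toFun hk) hx
    · exact ⟨j, rfl⟩
  · rw [(S.measurePreserving hβ).measure_preimage (measurableSet_singleton x).nullMeasurableSet]
    exact measure_singleton x

lemma isACIP_volume (hβ : 1 < β) : IsACIP S.toFun volume :=
  ⟨inferInstance, Measure.AbsolutelyContinuous.rfl, S.measurePreserving hβ⟩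

/-- A nonempty cylinder word determines an interval that an iterate maps affinely onto `(0, 1)`. -/
lemma exists_fullBranch_cylinder (hβ : 1 < β) (ha : a ∈ unitExpressions β) {L : ℕ}
    (w : Fin (L + 1) → Fin S.N) :
    ∃ p q r c, FullBranch (S.toFun^[L + 1]) p q r c ∧ q - p ≤ β⁻¹ ^ (L + 1) ∧
      ∀ x : I, x ∈ S.cylinder w ↔ (p < (x : ℝ) ∧ (x : ℝ) < q) := by
  have hβ0 : 0 < β := by linarith
  have hlen : ∀ k, (|((S.sign k : ℤ) : ℝ) * β ^ S.m k|)⁻¹ ≤ β⁻¹ := by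
    intro k
    rw [← (S.fullBranch hβ k).length_eq, S.length_eq, ← inv_pow]
    exact pow_le_of_le_one (inv_nonneg.2 hβ0.le) (inv_le_one_of_one_le₀ hβ.le)
      (by have := S.one_le_m ha k; omega)
  induction L with
  | zero =>
    refine ⟨_, _, _, _, by simpa using S.fullBranch hβ (w 0), ?_, fun x => ?_⟩
    · rw [(S.fullBranch hβ (w 0)).length_eq]
      simpa using hlen (w 0)
    · simp [cylinder, Fin.forall_fin_one]
  | succ L ih =>
    obtain ⟨p, q, r, c, hf, hpq, hiff⟩ := ih (fun i => w i.castSucc)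
    obtain ⟨p', q', c', hf', hiff'⟩ := (S.fullBranch hβ (w (Fin.last (L + 1)))).comp hf
    rw [← Function.iterate_succ'] at hf'
    refine ⟨p', q', _, c', hf', ?_, fun x => ?_⟩
    · rw [hf'.length_eq, abs_mul, mul_inv, pow_succ, mul_comm]
      rw [hf.length_eq] at hpq
      exact mul_le_mul hpq (hlen _) (by positivity) (by positivity)
    · rw [hiff', ← hiff]
      simp only [cylinder, Set.mem_ofPred_eq]
      rw [Fin.forall_fin_succ' (n := L + 1)]
      simp only [Fin.val_castSucc, Fin.val_last]
      rfl

lemma ae_forall_exists_mem_cylinder (hβ : 1 < β) :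
    ∀ᵐ x : I, ∀ L : ℕ, ∃ w : Fin L → Fin S.N, x ∈ S.cylinder w := by
  have h : ∀ᵐ x : I, ∀ n : ℕ, S.toFun^[n] x ∉ Set.range S.t := by
    rw [ae_all_iff]
    intro n
    have := ((S.measurePreserving hβ).iterate n).measure_preimage
      (Set.finite_range S.t).measurableSet.nullMeasurableSet
    rw [S.measure_range_t] at this
    rw [ae_iff]
    simpa using! this
  filter_upwards [h] with x hx L
  have hk : ∀ n, ∃ k : Fin S.N, S.toFun^[n] x ∈ Set.Ioo (S.t k.castSucc) (S.t k.succ) := by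
    intro n
    rcases S.mem_Ioo_or_eq (S.toFun^[n] x) with h | ⟨j, hj⟩
    · exact h
    · exact absurd ⟨j, hj.symm⟩ (hx n)
  choose k hk using hk
  exact ⟨fun i => k i, fun i => hk i⟩

/-- Almost every point lies in cylinders of all lengths. These are full branches shrinking
geometrically, and since they contain the point the distance constant is 1. -/
theorem zeroOneLaw (hβ : 1 < β) (ha : a ∈ unitExpressions β) : ZeroOneLaw S.toFun := by
  intro A hA hinv hpos
  refine measure_compl_eq_zero_of_fullBranch 1 ?_ hA hinv hpos
  filter_upwards [S.ae_forall_exists_mem_cylinder hβ] with x hx ε hε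
  obtain ⟨n, hn⟩ : ∃ n : ℕ, (β⁻¹) ^ n < ε := exists_pow_lt_of_lt_one hε (inv_lt_one_of_one_lt₀ hβ)
  obtain ⟨w, hw⟩ := hx (n + 1)
  obtain ⟨p, q, r, c, hf, hpq, hiff⟩ := S.exists_fullBranch_cylinder hβ ha w
  have hxw := (hiff x).1 hw
  refine ⟨n + 1, p, q, r, c, hf, lt_of_le_of_lt (hpq.trans ?_) hn, ?_⟩
  · exact pow_le_pow_of_le_one (inv_nonneg.2 (by linarith)) (inv_le_one_of_one_le₀ hβ.le)
      (Nat.le_succ n)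
  · rw [abs_le]
    constructor <;> linarith

end LurothMap

/-! ### Coupling the orbits and transferring genericity -/

/-- The difference obeys `f ↦ β f + d` with a digit `d` between 0 and `⌊β⌋`, so for fixed `j` it
takes finitely many values. -/
lemma exists_finite_betaMap_iterate_sub {β : ℝ} (hβ : 1 < β) (j : ℕ) :
    ∃ F : Set ℝ, F.Finite ∧ (∀ f ∈ F, f ∈ Algebra.adjoin ℤ ({β, β⁻¹} : Set ℝ)) ∧
      ∀ y : I, β ^ j * y - ((betaMap β)^[j] y : ℝ) ∈ F := by
  induction j with
  | zero => exact ⟨{0}, Set.finite_singleton 0, by simp, by simp⟩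
  | succ j ih =>
    obtain ⟨F, hF, hFβ, hy⟩ := ih
    refine ⟨Set.image2 (fun f (d : ℤ) => β * f + d) F (Set.Icc 0 ⌊β⌋),
      hF.image2 _ (Set.finite_Icc _ _), ?_, fun y => ?_⟩
    · rintro _ ⟨f, hf, d, -, rfl⟩
      exact add_mem (mul_mem (Algebra.subset_adjoin (by simp)) (hFβ f hf)) (intCast_mem _ _)
    · have h0 := ((betaMap β)^[j] y).2.1
      have h1 := ((betaMap β)^[j] y).2.2
      refine ⟨_, hy y, ⌊β * ((betaMap β)^[j] y : ℝ)⌋, ⟨?_, ?_⟩, ?_⟩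
      · exact Int.floor_nonneg.2 (mul_nonneg (by linarith) h0)
      · exact Int.floor_le_floor (by nlinarith)
      · rw [Function.iterate_succ_apply', coe_betaMap, Int.fract]
        ring

lemma Int.units_cast_mul_self (u : ℤˣ) : ((u : ℤ) : ℝ) * ((u : ℤ) : ℝ) = 1 := by
  rcases Int.units_eq_one_or u with rfl | rfl <;> simp

namespace LurothMap

variable {β : ℝ} {a : ℕ →₀ ℕ} (S : LurothMap β a)

/-- Up to sign and finitely many translations, the orbit under `S` is a subsequence with bounded gaps
of the orbit under the beta transformation. -/
theorem exists_coupling (hβ : IsPisot β) (ha : a ∈ unitExpressions β) (x : I) :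
    ∃ (D : ℕ) (M : ℕ → ℕ) (W : Set ℝ), W.Finite ∧ M 0 = 0 ∧ (∀ n, M n < M (n + 1)) ∧
      (∀ n, M (n + 1) ≤ M n + D) ∧
      ∀ n, ∃ (u : ℤˣ), ∃ w ∈ W,
        (S.toFun^[n] x : ℝ) = ((u : ℤ) : ℝ) * ((betaMap β)^[M n] x : ℝ) + w := by
  have h1 := hβ.2.1
  choose k e he hS using S.exists_eq_affine_add h1
  choose F hF hFβ hFy using exists_finite_betaMap_iterate_sub h1
  obtain ⟨D, hD⟩ := (Set.finite_range S.m).bddAbove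
  have hD' : ∀ k, S.m k ≤ D := fun k => hD ⟨k, rfl⟩
  set E : Set ℝ := insert 0 (Set.image2 (· + ·)
    (Set.image2 (fun (k : Fin S.N) (e : ℤ) => S.intercept k + e) Set.univ (Set.Icc (-1) 1))
    (Set.image2 (fun (u : ℤˣ) (f : ℝ) => ((u : ℤ) : ℝ) * f) Set.univ
      (⋃ j ∈ Set.Iic D, F j))) with hE
  have hEfin : E.Finite := by
    refine Set.Finite.insert _ (Set.Finite.image2 _ ?_ ?_)
    · exact Set.Finite.image2 _ Set.finite_univ (Set.finite_Icc _ _)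
    · exact Set.Finite.image2 _ Set.finite_univ ((Set.finite_Iic D).biUnion fun j _ => hF j)
  have hEβ : ∀ z ∈ E, z ∈ Algebra.adjoin ℤ ({β, β⁻¹} : Set ℝ) := by
    rintro z (rfl | ⟨_, ⟨k, -, e, -, rfl⟩, _, ⟨u, -, f, hf, rfl⟩, rfl⟩)
    · exact zero_mem _
    · simp only [Set.mem_iUnion] at hf
      obtain ⟨j, -, hf⟩ := hf
      exact add_mem (add_mem (S.intercept_mem_adjoin h1 k) (intCast_mem _ _))
        (mul_mem (intCast_mem _ _) (hFβ j f hf))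
  -- The total exponent of `β` applied by the first `n` steps of `S`: the time at which `T` has
  -- expanded equally.
  set M : ℕ → ℕ := fun n => ∑ i ∈ Finset.range n, S.m (k (S.toFun^[i] x)) with hM
  have hMsucc : ∀ n, M (n + 1) = M n + S.m (k (S.toFun^[n] x)) := fun n =>
    Finset.sum_range_succ _ _
  -- The offset `w` is a point of `[0, 1]` plus or minus another, so `|w| ≤ 2`.
  refine ⟨D, M, _, hβ.finite_affineReach hEfin hEβ 2, by simp [hM], ?_, ?_, ?_⟩
  · intro n
    have := S.one_le_m ha (k (S.toFun^[n] x))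
    rw [hMsucc]; omega
  · intro n
    rw [hMsucc]
    exact Nat.add_le_add_left (hD' _) _
  · have key : ∀ n, ∃ (u : ℤˣ) (w : ℝ), AffineReach β E w ∧
        (S.toFun^[n] x : ℝ) = ((u : ℤ) : ℝ) * ((betaMap β)^[M n] x : ℝ) + w := by
      intro n
      induction n with
      | zero => exact ⟨1, 0, AffineReach.base _ (by simp [hE]), by simp [hM]⟩
      | succ n ih =>
        obtain ⟨u, w, hw, hrel⟩ := ih
        set y := S.toFun^[n] x with hy
        set v := (betaMap β)^[M n] x with hv
        have hm := S.one_le_m ha (k y)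
        have hf := hFy (S.m (k y)) v
        -- Write `β^m v = T^m v + f` with `f` from the finite set. The new offset is then `±β^m w`
        -- plus the branch intercept, the endpoint error and `±f`.
        refine ⟨S.sign (k y) * u, _, AffineReach.step w
          ((S.intercept (k y) + e y) + (((S.sign (k y) * u : ℤˣ) : ℤ) : ℝ) *
            (β ^ S.m (k y) * v - ((betaMap β)^[S.m (k y)] v : ℝ)))
          (S.sign (k y)) (S.m (k y)) hw ?_ hm, ?_⟩
        · refine Or.inr ⟨_, ⟨k y, trivial, e y, he y, rfl⟩, _, ⟨S.sign (k y) * u, trivial, _, ?_, rfl⟩,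
            rfl⟩
          simp only [Set.mem_iUnion]
          exact ⟨_, hD' (k y), hf⟩
        · rw [Function.iterate_succ_apply', ← hy, hS y, hrel, hMsucc, add_comm (M n),
            Function.iterate_add_apply, ← hv]
          push_cast
          ring
    intro n
    obtain ⟨u, w, hw, hrel⟩ := key n
    refine ⟨u, w, ⟨hw, ?_⟩, hrel⟩
    have hu : |((u : ℤ) : ℝ)| = 1 := by
      rcases Int.units_eq_one_or u with h | h <;> simp [h]
    have e1 : w = (S.toFun^[n] x : ℝ) - ((u : ℤ) : ℝ) * ((betaMap β)^[M n] x : ℝ) := by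
      rw [hrel]; ring
    rw [e1]
    refine (abs_sub _ _).trans ?_
    rw [abs_mul, hu, one_mul, abs_of_nonneg (S.toFun^[n] x).2.1,
      abs_of_nonneg ((betaMap β)^[M n] x).2.1]
    linarith [(S.toFun^[n] x).2.2, ((betaMap β)^[M n] x).2.2]

theorem hasDensityBound_of_betaMap (hβ : IsPisot β) (ha : a ∈ unitExpressions β) {x : I} {C : ℝ}
    (hC : 0 ≤ C) (h : HasDensityBound (fun n => (betaMap β)^[n] x) C) :
    ∃ C', 0 ≤ C' ∧ HasDensityBound (fun n => S.toFun^[n] x) C' := by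
  obtain ⟨D, M, W, hW, hM0, hM1, hM2, hrel⟩ := S.exists_coupling hβ ha x
  have hmono : StrictMono M := strictMono_nat_of_lt_succ hM1
  have hD : 1 ≤ D := by have := hM1 0; have := hM2 0; omega
  have hMle : ∀ n, M n ≤ D * n := by
    intro n
    induction n with
    | zero => simp [hM0]
    | succ n ih => have := hM2 n; rw [Nat.mul_succ]; omega
  refine h.of_affine hC
    (Set.image2 (fun (u : ℤˣ) (w : ℝ) => (((u : ℤ) : ℝ), -(((u : ℤ) : ℝ) * w))) Set.univ W)
    (Set.Finite.image2 _ Set.finite_univ hW) D M ?_ ?_ ?_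
  · intro n
    have := hMle n
    rw [Nat.mul_succ]; omega
  · intro k N
    refine le_trans (Finset.card_le_one.2 ?_) hD
    intro i hi j hj
    simp only [Finset.mem_filter] at hi hj
    exact hmono.injective (hi.2.trans hj.2.symm)
  · intro n
    obtain ⟨u, w, hw, h⟩ := hrel n
    refine ⟨_, ⟨u, trivial, w, hw, rfl⟩, ?_⟩
    simp only
    rw [h]
    linear_combination (-((betaMap β)^[M n] x : ℝ)) * Int.units_cast_mul_self u

/-- Here the coupling must be filled in between the times `M n`. For `m = M n + j` with `j ≤ D`,
`T^(M n) x` equals `β^(-j) (T^m x + f)` with `f` from a finite set, so `S^n x` is still one of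
finitely many affine images of `T^m x`. -/
theorem hasDensityBound_betaMap (hβ : IsPisot β) (ha : a ∈ unitExpressions β) {x : I} {C : ℝ}
    (hC : 0 ≤ C) (h : HasDensityBound (fun n => S.toFun^[n] x) C) :
    ∃ C', 0 ≤ C' ∧ HasDensityBound (fun n => (betaMap β)^[n] x) C' := by
  obtain ⟨D, M, W, hW, hM0, hM1, hM2, hrel⟩ := S.exists_coupling hβ ha x
  have hβ0 : 0 < β := by linarith [hβ.2.1]
  choose F hF hFβ hFy using exists_finite_betaMap_iterate_sub hβ.2.1
  have hmono : StrictMono M := strictMono_nat_of_lt_succ hM1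
  have hD : 1 ≤ D := by have := hM1 0; have := hM2 0; omega
  have hr : ∀ m, ∃ n, M n ≤ m ∧ m < M (n + 1) := by
    intro m
    induction m with
    | zero => exact ⟨0, by omega, by have := hM1 0; omega⟩
    | succ m ih =>
      obtain ⟨n, hn1, hn2⟩ := ih
      by_cases hc : m + 1 < M (n + 1)
      · exact ⟨n, by omega, hc⟩
      · exact ⟨n + 1, by omega, by have := hM1 (n + 1); omega⟩
  choose r hr1 hr2 using hr
  refine h.of_affine hC
    (Set.image2 (fun (p : ℤˣ × ℕ) (q : ℝ × ℝ) => (((p.1 : ℤ) : ℝ) * (β ^ p.2)⁻¹,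
      ((p.1 : ℤ) : ℝ) * (β ^ p.2)⁻¹ * q.1 + q.2)) (Set.univ ×ˢ Set.Iic D)
      ((⋃ j ∈ Set.Iic D, F j) ×ˢ W))
    (Set.Finite.image2 _ (Set.finite_univ.prod (Set.finite_Iic D))
      (((Set.finite_Iic D).biUnion fun j _ => hF j).prod hW)) D r ?_ ?_ ?_
  · intro m
    have h1 := hmono.id_le (r m)
    have h2 := hr1 m
    simp only [id] at h1
    nlinarith
  · intro k N
    calc _ ≤ (Finset.Ico (M k) (M k + D)).card := by
          refine Finset.card_le_card fun m hm => ?_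
          simp only [Finset.mem_filter, Finset.mem_Ico] at hm ⊢
          obtain ⟨-, rfl⟩ := hm
          exact ⟨hr1 m, (hr2 m).trans_le (hM2 _)⟩
      _ = D := by simp
  · intro m
    obtain ⟨u, w, hw, h⟩ := hrel (r m)
    obtain ⟨j, hj⟩ := Nat.exists_eq_add_of_le (hr1 m)
    have hjD : j ≤ D := by have := hr2 m; have := hM2 (r m); omega
    have hf := hFy j ((betaMap β)^[M (r m)] x)
    rw [← Function.iterate_add_apply, add_comm j, ← hj] at hf
    refine ⟨_, ⟨(u, j), ⟨trivial, hjD⟩,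
      (β ^ j * ((betaMap β)^[M (r m)] x : ℝ) - ((betaMap β)^[m] x : ℝ), w), ⟨?_, hw⟩, rfl⟩, ?_⟩
    · simp only [Set.mem_iUnion]
      exact ⟨j, hjD, hf⟩
    · simp only
      rw [h]
      field_simp
      ring

theorem generic_iff_betaMap_generic (hβ : IsPisot β) (ha : a ∈ unitExpressions β) {μ : Measure I}
    (hμ : IsACIP (betaMap β) μ) (x : I) :
    IsGenericForMeasure S.toFun volume x ↔ IsGenericForMeasure (betaMap β) μ x := by
  have h1 := hβ.2.1
  have := hμ.prob
  constructor
  · intro h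
    obtain ⟨C, -, hC⟩ := S.hasDensityBound_betaMap hβ ha zero_le_one
      (hasDensityBound_of_generic zero_le_one (by simp) h)
    exact generic_of_hasDensityBound (tameMap_betaMap h1)
      (fun ν hν => hβ.zeroOneLaw_betaMap.unique hν hμ) hC
  · intro h
    obtain ⟨μ', C, hC, hμ', hbd⟩ := exists_isACIP_betaMap h1
    -- Uniqueness identifies `μ` with Parry's measure, whose density is bounded.
    obtain rfl := hβ.zeroOneLaw_betaMap.unique hμ hμ'
    obtain ⟨C', -, hC'⟩ := S.hasDensityBound_of_betaMap hβ ha hC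
      (hasDensityBound_of_generic hC hbd h)
    exact generic_of_hasDensityBound (S.tameMap h1)
      (fun ν hν => (S.zeroOneLaw h1 ha).unique hν (S.isACIP_volume h1)) hC'

end LurothMap

/-! ### Normality and genericity -/

lemma visits_biUnion {ι : Type*} (y : ℕ → I) (A : ι → Set I) (s : Finset ι)
    (hA : Pairwise (Function.onFun Disjoint A)) (n : ℕ) :
    visits y (⋃ i ∈ s, A i) n = ∑ i ∈ s, visits y (A i) n := by
  classical
  unfold visits
  rw [← Finset.card_biUnion]
  · congr 1
    ext j
    simp only [Set.mem_iUnion, Finset.mem_filter, Finset.mem_biUnion]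
    grind
  · intro i _ j _ hij
    rw [Function.onFun, Finset.disjoint_left]
    intro k hk hk'
    exact Set.disjoint_left.1 (hA hij) (Finset.mem_filter.1 hk).2 (Finset.mem_filter.1 hk').2

lemma tendsto_visits_div_of_generic {U : I → I} {μ : Measure I} [IsProbabilityMeasure μ] {x : I}
    (h : IsGenericForMeasure U μ x) {A : Set I} (hA : MeasurableSet A) (hfr : μ (frontier A) = 0) :
    Tendsto (fun n : ℕ => (visits (fun j => U^[j] x) A n : ℝ) / n) atTop (𝓝 (μ.real A)) := by
  have hlim := (isGenericForMeasure_iff_tendsto_empirical U ⟨μ, inferInstance⟩ x).1 h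
  have h1 := ProbabilityMeasure.tendsto_measure_of_null_frontier_of_tendsto' hlim hfr
  have h2 := (ENNReal.tendsto_toReal (measure_ne_top μ A)).comp h1
  rw [← tendsto_add_atTop_iff_nat 1]
  refine h2.congr fun n => ?_
  rw [Function.comp_apply, empirical_apply _ _ hA, ENNReal.toReal_ofReal (by positivity)]
  push_cast
  rfl

namespace LurothMap

variable {β : ℝ} {a : ℕ →₀ ℕ} (S : LurothMap β a)

lemma isNormal_iff (x : I) :
    S.IsNormal x ↔ ∀ (L : ℕ) (w : Fin L → Fin S.N),
      Tendsto (fun n : ℕ => (visits (fun j => S.toFun^[j] x) (S.cylinder w) n : ℝ) / n) atTop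
        (𝓝 (volume.real (S.cylinder w))) := Iff.rfl

lemma pairwise_disjoint_cylinder (hβ : 1 < β) (L : ℕ) :
    Pairwise (Function.onFun Disjoint fun w : Fin L → Fin S.N => S.cylinder w) := by
  intro w w' hww'
  rw [Function.onFun, Set.disjoint_left]
  intro x hx hx'
  obtain ⟨i, hi⟩ := Function.ne_iff.1 hww'
  exact Set.disjoint_left.1 (S.pairwise_disjoint_Ioo hβ hi) (hx i) (hx' i)

lemma cylinder_eq_preimage_Ioo (hβ : 1 < β) (ha : a ∈ unitExpressions β) {L : ℕ}
    (w : Fin (L + 1) → Fin S.N) :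
    ∃ p q : ℝ, q - p ≤ β⁻¹ ^ (L + 1) ∧ S.cylinder w = Subtype.val ⁻¹' Set.Ioo p q := by
  obtain ⟨p, q, r, c, -, hpq, hiff⟩ := S.exists_fullBranch_cylinder hβ ha w
  exact ⟨p, q, hpq, Set.ext hiff⟩

lemma measurableSet_cylinder (hβ : 1 < β) (ha : a ∈ unitExpressions β) {L : ℕ}
    (w : Fin (L + 1) → Fin S.N) : MeasurableSet (S.cylinder w) := by
  obtain ⟨p, q, -, h⟩ := S.cylinder_eq_preimage_Ioo hβ ha w
  rw [h]
  exact measurable_subtype_coe measurableSet_Ioo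

lemma measure_frontier_cylinder (hβ : 1 < β) (ha : a ∈ unitExpressions β) {L : ℕ}
    (w : Fin (L + 1) → Fin S.N) : volume (frontier (S.cylinder w)) = 0 := by
  obtain ⟨p, q, -, h⟩ := S.cylinder_eq_preimage_Ioo hβ ha w
  rw [h]
  refine measure_mono_null ?_ (((Set.toFinite ({p, q} : Set ℝ)).countable.preimage
    Subtype.val_injective).measure_zero volume)
  refine (continuous_subtype_val.frontier_preimage_subset _).trans (Set.preimage_mono ?_)
  by_cases hpq : p < q
  · rw [frontier_Ioo hpq]
  · rw [Set.Ioo_eq_empty hpq, frontier_empty]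
    exact Set.empty_subset _

theorem isNormal_of_generic (hβ : 1 < β) (ha : a ∈ unitExpressions β) {x : I}
    (h : IsGenericForMeasure S.toFun volume x) : S.IsNormal x := by
  rw [isNormal_iff]
  intro L w
  cases L with
  | zero =>
    have : S.cylinder w = Set.univ := by
      ext y; simp [cylinder]
    rw [this]
    exact tendsto_visits_div_of_generic h MeasurableSet.univ (by simp)
  | succ L =>
    exact tendsto_visits_div_of_generic h (S.measurableSet_cylinder hβ ha w)
      (S.measure_frontier_cylinder hβ ha w)

/-- Cylinders finer than `r` that miss `K` fill almost everything outside the `r`-neighbourhood of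
`K`, and normality gives their visit frequency. Visits to `K` fall in the complement of their union,
so orbits hitting partition points need no separate care. -/
lemma hasDensityBound_of_isNormal (hβ : 1 < β) (ha : a ∈ unitExpressions β) {x : I}
    (h : S.IsNormal x) : HasDensityBound (fun n => S.toFun^[n] x) 1 := by
  classical
  rw [isNormal_iff] at h
  intro K hK δ hδ
  obtain ⟨r, hr, hrK⟩ : ∃ r > 0, volume.real (Metric.cthickening r K) < volume.real K + δ / 2 := by
    have h1 := tendsto_measure_cthickening_of_isClosed (μ := (volume : Measure I)) (s := K)
      ⟨1, one_pos, measure_ne_top _ _⟩ hK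
    have h2 := (((ENNReal.tendsto_toReal (measure_ne_top _ _)).comp h1).mono_left
      (nhdsWithin_le_nhds (s := Set.Ioi 0))).eventually_lt_const
      (show (volume K).toReal < volume.real K + δ / 2 by rw [measureReal_def]; linarith)
    obtain ⟨r, hr1, hr2⟩ := (h2.and self_mem_nhdsWithin).exists
    exact ⟨r, hr2, hr1⟩
  obtain ⟨L, hL⟩ : ∃ L : ℕ, (β⁻¹) ^ L < r := exists_pow_lt_of_lt_one hr (inv_lt_one_of_one_lt₀ hβ)
  set G : Finset (Fin (L + 1) → Fin S.N) := Finset.univ.filter fun w => Disjoint (S.cylinder w) K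
  set B : Set I := ⋃ w ∈ G, S.cylinder w with hB
  have hBK : K ⊆ Bᶜ := by
    intro y hy hyB
    simp only [hB, Set.mem_iUnion] at hyB
    obtain ⟨w, hw, hyw⟩ := hyB
    exact Set.disjoint_left.1 (Finset.mem_filter.1 hw).2 hyw hy
  have hBm : MeasurableSet B :=
    G.measurableSet_biUnion fun w _ => S.measurableSet_cylinder hβ ha w
  have hBvol : 1 - volume.real (Metric.cthickening r K) ≤ volume.real B := by
    have hle : volume Bᶜ ≤ volume (Metric.cthickening r K) := by
      refine measure_mono_ae ?_
      filter_upwards [S.ae_forall_exists_mem_cylinder hβ] with y hy hyB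
      obtain ⟨w, hw⟩ := hy (L + 1)
      by_cases hwG : w ∈ G
      · exact absurd (Set.mem_biUnion hwG hw) hyB
      · simp only [G, Finset.mem_filter, Finset.mem_univ, true_and, Set.not_disjoint_iff] at hwG
        obtain ⟨z, hzw, hzK⟩ := hwG
        obtain ⟨p, q, hpq, hcyl⟩ := S.cylinder_eq_preimage_Ioo hβ ha w
        rw [hcyl] at hw hzw
        refine Metric.mem_cthickening_of_dist_le y z r K hzK ?_
        have hpow : β⁻¹ ^ (L + 1) ≤ β⁻¹ ^ L :=
          pow_le_pow_of_le_one (inv_nonneg.2 (by linarith)) (inv_le_one_of_one_le₀ hβ.le)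
            (Nat.le_succ L)
        rw [Subtype.dist_eq, Real.dist_eq, abs_le]
        constructor <;> linarith [hw.1, hw.2, hzw.1, hzw.2]
    have h1 := ENNReal.toReal_mono (measure_ne_top _ _) hle
    have h2 := probReal_compl_eq_one_sub (μ := (volume : Measure I)) hBm
    simp only [measureReal_def] at h1 h2 ⊢
    linarith
  have hlim : Tendsto (fun n : ℕ => (visits (fun j => S.toFun^[j] x) B n : ℝ) / n) atTop
      (𝓝 (volume.real B)) := by
    have h1 : volume.real B = ∑ w ∈ G, volume.real (S.cylinder w) :=
      measureReal_biUnion_finset ((S.pairwise_disjoint_cylinder hβ (L + 1)).set_pairwise _)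
        fun w _ => S.measurableSet_cylinder hβ ha w
    rw [h1]
    refine (tendsto_finsetSum G fun w _ => h (L + 1) w).congr fun n => ?_
    rw [hB, visits_biUnion _ _ _ (S.pairwise_disjoint_cylinder hβ (L + 1))]
    push_cast
    rw [Finset.sum_div]
  filter_upwards [hlim.eventually_const_lt (show volume.real B - δ / 2 < volume.real B by linarith),
    eventually_gt_atTop 0] with n hn hn0
  have hn0' : (0 : ℝ) < n := by exact_mod_cast hn0
  rw [lt_div_iff₀ hn0'] at hn
  have h1 : (visits (fun j => S.toFun^[j] x) K n : ℝ) ≤ visits (fun j => S.toFun^[j] x) Bᶜ n := by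
    exact_mod_cast visits_mono _ hBK n
  have h2 : (visits (fun j => S.toFun^[j] x) B n : ℝ) + visits (fun j => S.toFun^[j] x) Bᶜ n = n := by
    exact_mod_cast visits_add_compl _ B n
  nlinarith

theorem isNormal_iff_generic (hβ : 1 < β) (ha : a ∈ unitExpressions β) (x : I) :
    S.IsNormal x ↔ IsGenericForMeasure S.toFun volume x :=
  ⟨fun h => generic_of_hasDensityBound (S.tameMap hβ)
    (fun _ hν => (S.zeroOneLaw hβ ha).unique hν (S.isACIP_volume hβ))
    (S.hasDensityBound_of_isNormal hβ ha h), S.isNormal_of_generic hβ ha⟩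

end LurothMap

/-! ### Infinitely many expressions of one -/

/-- Substituting an expression of one into one of its own terms gives a longer expression. -/
lemma exists_longer_unitExpression {β : ℝ} (hβ : 1 < β) {a : ℕ →₀ ℕ} (ha : a ∈ unitExpressions β) :
    ∃ a' ∈ unitExpressions β, (a.sum fun _ n => n) < a'.sum fun _ n => n := by
  obtain ⟨h0, h1⟩ := ha
  have hβ0 : β ≠ 0 := by linarith
  obtain ⟨i, hi⟩ : ∃ i, a i ≠ 0 := by
    by_contra! h
    have : a = 0 := Finsupp.ext h
    simp [this] at h1
  have hi0 : i ≠ 0 := fun h => hi (h ▸ h0)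
  set b := a - Finsupp.single i 1 with hb
  have hab : a = b + Finsupp.single i 1 := by
    rw [hb, tsub_add_cancel_of_le]
    rw [Finsupp.single_le_iff]
    exact Nat.one_le_iff_ne_zero.2 hi
  have hadd : ∀ f g : ℕ →₀ ℕ, ((f + g).sum fun i n => (n : ℝ) / β ^ i)
      = (f.sum fun i n => (n : ℝ) / β ^ i) + g.sum fun i n => (n : ℝ) / β ^ i := fun f g =>
    Finsupp.sum_add_index' (by simp) (by intros; push_cast; ring)
  have hcount : ∀ f g : ℕ →₀ ℕ, ((f + g).sum fun _ n => n)
      = (f.sum fun _ n => n) + g.sum fun _ n => n := fun f g =>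
    Finsupp.sum_add_index' (by simp) (by simp)
  have hsingle : ((Finsupp.single i 1).sum fun i n => ((n : ℕ) : ℝ) / β ^ i) = 1 / β ^ i := by
    rw [Finsupp.sum_single_index] <;> simp
  have hVb := h1
  rw [hab, hadd, hsingle] at hVb
  -- One term `β^(-i)` is replaced by `β^(-i)` times the whole expression, that is, `a` shifted by
  -- `i`.
  refine ⟨b + a.mapDomain (· + i), ⟨?_, ?_⟩, ?_⟩
  · have hb0 : b 0 = 0 := by simp [hb, h0]
    rw [Finsupp.add_apply, hb0, zero_add]
    exact Finsupp.mapDomain_of_notMem_range _ _ (by simp [hi0])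
  · rw [hadd, Finsupp.sum_mapDomain_index (by simp) (by intros; push_cast; ring)]
    have : (a.sum fun j n => (n : ℝ) / β ^ (j + i)) = 1 / β ^ i := by
      have h2 : (a.sum fun j n => (n : ℝ) / β ^ (j + i))
          = (a.sum fun j n => (n : ℝ) / β ^ j) * (1 / β ^ i) := by
        rw [Finsupp.sum_mul]
        refine Finsupp.sum_congr fun j _ => ?_
        rw [pow_add]
        field_simp
      rw [h2, ← h1, one_mul]
    rw [this]
    exact hVb
  · rw [hcount, Finsupp.sum_mapDomain_index (by simp) (by simp)]
    -- The term count grows from `|a|` to `|b| + |a|`. If nothing remained in `b`, the expression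
    -- would read `1 = β^(-i)`, impossible for `β > 1` and `i ≠ 0`.
    have hbpos : 0 < b.sum fun _ n => n := by
      rw [Nat.pos_iff_ne_zero]
      intro hz
      have hbz : b = 0 := by
        ext j
        by_contra hj
        exact hj ((Finset.sum_eq_zero_iff.1 hz) j (Finsupp.mem_support_iff.2 hj))
      rw [hbz, Finsupp.sum_zero_index, zero_add, eq_comm, div_eq_one_iff_eq (pow_ne_zero _ hβ0)] at hVb
      exact (one_lt_pow₀ hβ hi0).ne hVb
    omega

lemma unitExpressions_infinite {β : ℝ} (hβ : 1 < β) (h : (unitExpressions β).Nonempty) :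
    (unitExpressions β).Infinite := by
  intro hfin
  obtain ⟨a, ha, hmax⟩ := Set.exists_max_image _ (fun a : ℕ →₀ ℕ => a.sum fun _ n => n) hfin h
  obtain ⟨a', ha', hlt⟩ := exists_longer_unitExpression hβ ha
  exact absurd (hmax a' ha') (not_le.2 hlt)

/-! ### The main theorem -/

theorem mainTheorem7 (β : ℝ) (hβ : IsPisot β) (hpos : NoOtherPositiveConjugate β) :
    (∃! μ : Measure I, IsACIP (betaMap β) μ) ∧
    ((unitExpressions β).Nonempty → (unitExpressions β).Infinite) ∧
    ∀ a ∈ unitExpressions β, ∀ S : LurothMap β a,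
      (∀ ν : Measure I, IsACIP S.toFun ν ↔ ν = volume) ∧
      (∀ μ : Measure I, IsACIP (betaMap β) μ →
        GenericPointEquivalent S.toFun volume (betaMap β) μ) ∧
      (∀ a' ∈ unitExpressions β, ∀ S' : LurothMap β a',
        GenericPointEquivalent S.toFun volume S'.toFun volume ∧ NormalityEquivalent S S') := by
  have h1 := hβ.2.1
  obtain ⟨μ₀, -, -, hμ₀, -⟩ := exists_isACIP_betaMap h1
  have herg : ∀ a ∈ unitExpressions β, ∀ S : LurothMap β a, Ergodic S.toFun volume :=
    fun a ha S => (S.zeroOneLaw h1 ha).ergodic (S.isACIP_volume h1)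
  refine ⟨⟨μ₀, hμ₀, fun ν hν => hβ.zeroOneLaw_betaMap.unique hν hμ₀⟩, unitExpressions_infinite h1,
    fun a ha S => ⟨fun ν => ⟨fun hν => (S.zeroOneLaw h1 ha).unique hν (S.isACIP_volume h1), ?_⟩,
      fun μ hμ => ?_, fun a' ha' S' => ?_⟩⟩
  · rintro rfl
    exact S.isACIP_volume h1
  · exact ⟨inferInstance, hμ.prob, herg a ha S, hβ.zeroOneLaw_betaMap.ergodic hμ,
      Set.ext fun x => S.generic_iff_betaMap_generic hβ ha hμ x⟩
  · have hgen : ∀ x, IsGenericForMeasure S.toFun volume x ↔ IsGenericForMeasure S'.toFun volume x :=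
      fun x => (S.generic_iff_betaMap_generic hβ ha hμ₀ x).trans
        (S'.generic_iff_betaMap_generic hβ ha' hμ₀ x).symm
    refine ⟨⟨inferInstance, inferInstance, herg a ha S, herg a' ha' S', Set.ext hgen⟩,
      Set.ext fun x => ?_⟩
    exact ((S.isNormal_iff_generic h1 ha x).trans (hgen x)).trans
      (S'.isNormal_iff_generic h1 ha' x).symm
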